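/- Let $1<p\le 2$. Let $d\ge 1$, $L,\sigma>0$, let $(\Xi,\mathcal F,P)$ be a probability space and $F:\mathbb R^d\times\Xi\to\mathbb R$ be such that $F(x;\cdot)$ is measurable and $P$-integrable for every $x$ and $F(\cdot;\xi)$ is differentiable for every $\xi$. Put $f(x)=\mathbb E_{\xi\sim P}F(x;\xi)$ and assume: (a) $f_*=\inf f>-\infty$; (b) for $P$-almost every $\xi$, $\|\nabla F(x;\xi)-\nabla F(y;\xi)\|\le L\|x-y\|$ for all $x,y$; (c) $P(\|\nabla F(x;\xi)-\nabla f(x)\|>t)\le(\sigma/t)^p$ for all $x$ and all $t>0$. Let $x_0\in\mathbb R^d$ and $\Delta_0=f(x_0)-f_*$. For $\mu,\epsilon>0$, $\delta\in(0,1]$ and $M\in\mathbb N$ put $$\bar\Delta_0=\Delta_0+\tfrac{L\mu^2}{2},\qquad S_\mu=\frac{\sqrt{L\bar\Delta_0}+\sigma}{\sqrt d}+L\mu,\qquad T=\max\Bigl\{3,\Bigl\lceil\frac{32L\bar\Delta_0}{\epsilon^2}\Bigr\rceil\Bigr\},\qquad C_p=120+\frac{2^{4-p}}{p-1},$$ $$\eta(M,\mu,\delta,T)=C_p\,d\,S_\mu\Bigl(\frac{\log(T/\delta)}{M}\Bigr)^{\frac{p-1}{p}}\sqrt{1+\log\frac{M}{\log(T/\delta)}}+L\mu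 .$$ Base RSC-ZO (no momentum) with batch size $M$, stepsize $\alpha=1/(4L)$ and clipping threshold $\tau=8S_\mu(M/\log(T/\delta))^{1/p}$ starts at $x_0$ and iterates $$x_{t+1}=x_t-\alpha\,\frac dM\sum_{\ell=1}^M\psi_\tau(Y_{t,\ell})\,u_{t,\ell},\qquad Y_{t,\ell}=\frac{F(x_t+\mu u_{t,\ell};\xi_{t,\ell})-F(x_t-\mu u_{t,\ell};\xi_{t,\ell})}{2\mu},$$ where $\psi_\tau(z)=z\min\{1,\tau/|z|\}$ (with $\psi_\tau(0)=0$) and the pairs $(u_{t,\ell},\xi_{t,\ell})$ are independent with law $\mathrm{Unif}(\mathbb S^{d-1})\otimes P$. (i) If $$M\ge\log(T/\delta),\qquad \eta(M,\mu,\delta,T)\le\frac{\epsilon}{4},\qquad \epsilon^2\le 32L\bar\Delta_0,\tag{$*$}$$ then, with probability at least $1-\delta$, $$\frac1T\sum_{t=0}^{T-1}\|\nabla f(x_t)\|^2\le\epsilon^2\qquad\text{and, on the same event,}\qquad \min_{0\le t<T}\|\nabla f(x_t)\|\le\epsilon .$$ The $T$ iterations make exactly $2MT$ queries of $F(\cdot;\cdot)$.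 (ii) There are $C>0$ and $k\in\mathbb N$ depending only on $p$ such that, whenever $\epsilon^2\le 32L\Delta_0$, there are $\mu>0$ and $M\in\mathbb N$, depending only on $p,d,L,\sigma,\Delta_0,\epsilon,\delta$, that satisfy $(*)$ and for which $$2MT\le C\,L\Delta_0\bigl(\sqrt{L\Delta_0}+\sigma\bigr)^{\frac p{p-1}}\,\frac{d^{\frac p{2(p-1)}}}{\epsilon^{\frac{3p-2}{p-1}}}\,\Bigl(\log\Bigl(2+\frac{\sqrt d\,(\sqrt{L\Delta_0}+\sigma)}{\epsilon\,\delta}\Bigr)\Bigr)^{k}.$$ That is, the query complexity is $\widetilde O\bigl(d^{\frac{p}{2(p-1)}}\epsilon^{-\frac{3p-2}{p-1}}\bigr)$. -/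

import Mathlib

open MeasureTheory ProbabilityTheory

namespace RSCZO

noncomputable section

/-- `ℝ^d` with its Euclidean norm. -/
abbrev E (d : ℕ) : Type := EuclideanSpace ℝ (Fin d)

/-- The unit sphere `S^(d-1)` of `ℝ^d`. -/
abbrev Sph (d : ℕ) : Type := Metric.sphere (0 : E d) 1

/-- The uniform distribution on the unit sphere: the normalized surface measure. -/
def unifSphere (d : ℕ) : Measure (Sph d) :=
  ((volume : Measure (E d)).toSphere Set.univ)⁻¹ • (volume : Measure (E d)).toSphere

section Problem

variable {Ξ : Type*} [MeasurableSpace Ξ] {d : ℕ}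

/-- The objective `f(x) = 𝔼_ξ F(x; ξ)`. -/
def objective (P : Measure Ξ) (F : E d → Ξ → ℝ) (x : E d) : ℝ := ∫ ξ, F x ξ ∂P

/-- `∇F(x; ξ)`, the gradient in the first variable. -/
def sampleGrad (F : E d → Ξ → ℝ) (x : E d) (ξ : Ξ) : E d := gradient (fun y => F y ξ) x

/-- The assumptions on the stochastic objective: `F(x; ξ)` is measurable in `ξ` and differentiable in
`x`, the expectation defining `f` exists, `f` is bounded below, almost every sample function is
`L`-smooth, and the sample-gradient noise has weak-`L_p` tails with scale `σ`, uniformly in `x`. -/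
structure Assumptions (P : Measure Ξ) (F : E d → Ξ → ℝ) (L σ p : ℝ) : Prop where
  measurable : ∀ x, Measurable (F x)
  differentiable : ∀ ξ, Differentiable ℝ (fun x => F x ξ)
  integrable : ∀ x, Integrable (F x) P
  bddBelow : BddBelow (Set.range (objective P F))
  sample_smooth : ∀ᵐ ξ ∂P, ∀ x y,
    ‖sampleGrad F x ξ - sampleGrad F y ξ‖ ≤ L * ‖x - y‖
  weak_tail : ∀ x : E d, ∀ t : ℝ, 0 < t →
    P {ξ | t < ‖sampleGrad F x ξ - gradient (objective P F) x‖} ≤ ENNReal.ofReal ((σ / t) ^ p)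

/-- The initial gap `Δ₀ = f(x₀) - inf f`. -/
def initialGap (P : Measure Ξ) (F : E d → Ξ → ℝ) (x₀ : E d) : ℝ :=
  objective P F x₀ - ⨅ x, objective P F x

end Problem

section Algorithm

variable {Ξ : Type*} {d : ℕ}

/-- Scalar clipping `ψ_τ(z) = z min {1, τ / |z|}` (and `ψ_τ(0) = 0`). -/
def clip (τ z : ℝ) : ℝ := z * min 1 (τ / |z|)

/-- The two-point directional estimate
`(F(x + μ u; ξ) - F(x - μ u; ξ)) / (2 μ)`, with the same `ξ` in both evaluations. -/
def twoPoint (F : E d → Ξ → ℝ) (μ : ℝ) (x : E d) (u : Sph d) (ξ : Ξ) : ℝ :=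
  (F (x + μ • (u : E d)) ξ - F (x - μ • (u : E d)) ξ) / (2 * μ)

/-- The clipped zeroth-order estimator `G_μ(x; M, τ)` built from the batch `(u_ℓ, ξ_ℓ)_{ℓ < M}`. -/
def estimator (F : E d → Ξ → ℝ) (μ τ : ℝ) {M : ℕ} (x : E d)
    (u : Fin M → Sph d) (ξ : Fin M → Ξ) : E d :=
  ((d : ℝ) / M) • ∑ ℓ, clip τ (twoPoint F μ x (u ℓ) (ξ ℓ)) • (u ℓ : E d)

/-- The iterates of base RSC-ZO (no momentum) on the sample batches `u t`, `ξ t`: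
`x_{t+1} = x_t - α G_μ(x_t; M, τ)`. -/
def iterates (F : E d → Ξ → ℝ) (μ τ α : ℝ) {M : ℕ} (x₀ : E d)
    (u : ℕ → Fin M → Sph d) (ξ : ℕ → Fin M → Ξ) : ℕ → E d
  | 0 => x₀
  | t + 1 =>
    iterates F μ τ α x₀ u ξ t - α • estimator F μ τ (iterates F μ τ α x₀ u ξ t) (u t) (ξ t)

/-- The list of all arguments `(y, ξ)` at which base RSC-ZO queries the noisy oracle `F(y; ξ)` when it
performs the iterations `0, …, T - 1`. -/
def queryLog (F : E d → Ξ → ℝ) (μ τ α : ℝ) {M : ℕ} (x₀ : E d)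
    (u : ℕ → Fin M → Sph d) (ξ : ℕ → Fin M → Ξ) (T : ℕ) : List (E d × Ξ) :=
  (List.range T).flatMap fun t => (List.finRange M).flatMap fun ℓ =>
    [(iterates F μ τ α x₀ u ξ t + μ • (u t ℓ : E d), ξ t ℓ),
     (iterates F μ τ α x₀ u ξ t - μ • (u t ℓ : E d), ξ t ℓ)]

/-- The random samples of the algorithm: the pairs `(u_{t,ℓ}, ξ_{t,ℓ})` are independent, each with
law `Unif(S^(d-1)) ⊗ P`. -/
structure IsSampleStream [MeasurableSpace Ξ] {Ω : Type*} [MeasurableSpace Ω] (ν : Measure Ω)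
    (P : Measure Ξ) {M : ℕ} (u : ℕ → Fin M → Ω → Sph d) (ξ : ℕ → Fin M → Ω → Ξ) : Prop where
  measurable_u : ∀ t ℓ, Measurable (u t ℓ)
  measurable_ξ : ∀ t ℓ, Measurable (ξ t ℓ)
  law : ∀ t ℓ, ν.map (fun ω => (u t ℓ ω, ξ t ℓ ω)) = (unifSphere d).prod P
  indep : iIndepFun (fun (i : ℕ × Fin M) (ω : Ω) => (u i.1 i.2 ω, ξ i.1 i.2 ω)) ν

end Algorithm

section Parameters

/-- `Δ̄₀ = Δ₀ + L μ² / 2`. -/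
def gapBar (L Δ₀ μ : ℝ) : ℝ := Δ₀ + L * μ ^ 2 / 2

/-- `S_μ = (√(L Δ̄₀) + σ) / √d + L μ`. -/
def scale (d : ℕ) (L σ Δ₀ μ : ℝ) : ℝ :=
  (Real.sqrt (L * gapBar L Δ₀ μ) + σ) / Real.sqrt d + L * μ

/-- The number of iterations `T = max {3, ⌈32 L Δ̄₀ / ε²⌉}`. -/
def horizon (L Δ₀ μ ε : ℝ) : ℕ := max 3 ⌈32 * L * gapBar L Δ₀ μ / ε ^ 2⌉₊

/-- The clipping threshold `τ = 8 S_μ (M / log (T / δ)) ^ (1 / p)`. -/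
def threshold (d : ℕ) (p L σ Δ₀ μ δ : ℝ) (M T : ℕ) : ℝ :=
  8 * scale d L σ Δ₀ μ * (M / Real.log (T / δ)) ^ (1 / p)

/-- `C_p = 120 + 2 ^ (4 - p) / (p - 1)`. -/
def constC (p : ℝ) : ℝ := 120 + 2 ^ (4 - p) / (p - 1)

/-- `η(M, μ, δ, T) = C_p d S_μ (log (T/δ) / M) ^ ((p-1)/p) √(1 + log (M / log (T/δ))) + L μ`. -/
def eta (d : ℕ) (p L σ Δ₀ : ℝ) (M : ℕ) (μ δ : ℝ) (T : ℕ) : ℝ :=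
  constC p * d * scale d L σ Δ₀ μ * (Real.log (T / δ) / M) ^ ((p - 1) / p)
    * Real.sqrt (1 + Real.log (M / Real.log (T / δ))) + L * μ

/-- The conditions on the smoothing parameter `μ` and the batch size `M`:
`μ > 0`, `M ≥ log (T/δ)`, `η(M, μ, δ, T) ≤ ε / 4` and `ε² ≤ 32 L Δ̄₀`, where `T` is the horizon. -/
structure Admissible (d : ℕ) (p L σ Δ₀ ε δ μ : ℝ) (M : ℕ) : Prop where
  mu_pos : 0 < μ
  log_le : Real.log (horizon L Δ₀ μ ε / δ) ≤ M
  eta_le : eta d p L σ Δ₀ M μ δ (horizon L Δ₀ μ ε) ≤ ε / 4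
  eps_le : ε ^ 2 ≤ 32 * L * gapBar L Δ₀ μ

end Parameters

end

end RSCZO

/-! Deterministically, `inexact_gradient_descent` shows that if every gradient estimate is within
ε/4 of the true gradient, descent with stepsize 1/(4L) has average squared gradient at most ε² after
T steps. The estimate is only good where the gradient is at most 2√(LΔ̄₀). This closes by induction:
while the errors are small the gap stays below 7Δ̄₀/4, and smoothness turns this gap into the
required gradient bound. Hence no a priori bound on the iterates is needed.

Probabilistically, `estimator_concentration` bounds the failure probability of one batch, at a fixed
point with controlled gradient, by exp(-log(T/δ)) = δ/T. Independence of the batch from the iterate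
(`IsSampleStream.measure_iterate_batch_le`) and a union bound over T steps give probability 1 - δ.

The estimation error has three parts. Smoothing bias is at most Lμ with no dimension factor, by a
reflection argument (`norm_twoPoint_mean_sub_gradient_le`). Clipping bias is the expected excess
over τ of a variable with tail of order p. Fluctuation is handled by a dimension-free Bernstein
inequality (`pi_norm_sum_gt_le`), based on cosh of the norm, with the truncated second moment from
`integral_min_sq_le_of_tail`. The dimension gain comes from `tail_inner_sphere`: a random direction
sees only a 1/√d fraction of the gradient and of the noise, so the factor d in the estimator costs
√d in the error.

For the complexity, μ of order ε/(L√d) makes the smoothing terms harmless, and M is found by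
inverting the error bound, the logarithm being absorbed by an explicit factor (`exists_batch_size`).
-/

namespace RSCZO

noncomputable section

open Set Filter Topology Metric
open scoped Pointwise

/-! ### Functions with Lipschitz gradient. -/

section Smooth

variable {H : Type*} [NormedAddCommGroup H] [InnerProductSpace ℝ H] [CompleteSpace H]

/-- First-order remainder of a function with Lipschitz gradient between two points of a ball. -/
lemma abs_sub_sub_inner_gradient_le {φ : H → ℝ} {L r : ℝ} (hL : 0 ≤ L) (hφ : Differentiable ℝ φ)
    (hlip : ∀ x y, ‖gradient φ x - gradient φ y‖ ≤ L * ‖x - y‖) {x a b : H}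
    (ha : ‖a - x‖ ≤ r) (hb : ‖b - x‖ ≤ r) :
    |φ a - φ b - inner ℝ (gradient φ x) (a - b)| ≤ L * r * ‖a - b‖ := by
  have h := (convex_closedBall x r).norm_image_sub_le_of_norm_hasFDerivWithin_le'
    (f := φ) (f' := fun z => InnerProductSpace.toDual ℝ H (gradient φ z)) (C := L * r)
    (φ := InnerProductSpace.toDual ℝ H (gradient φ x)) (x := b) (y := a)
    (fun z _ => (hφ z).hasGradientAt.hasFDerivAt.hasFDerivWithinAt)
    (fun z hz => by
      rw [← map_sub, LinearIsometryEquiv.norm_map]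
      refine (hlip z x).trans ?_
      gcongr
      simpa [dist_eq_norm] using hz)
    (by simpa [dist_eq_norm] using hb) (by simpa [dist_eq_norm] using ha)
  simpa using h

/-- The descent lemma. -/
lemma le_add_inner_gradient_add {φ : H → ℝ} {L : ℝ} (hφ : Differentiable ℝ φ)
    (hlip : ∀ x y, ‖gradient φ x - gradient φ y‖ ≤ L * ‖x - y‖) (x h : H) :
    φ (x + h) ≤ φ x + inner ℝ (gradient φ x) h + L / 2 * ‖h‖ ^ 2 := by
  have hd : ∀ t : ℝ, HasDerivAt
      (fun t : ℝ => φ (x + t • h) - t * inner ℝ (gradient φ x) h - L / 2 * t ^ 2 * ‖h‖ ^ 2)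
      (inner ℝ (gradient φ (x + t • h) - gradient φ x) h - L * t * ‖h‖ ^ 2) t := by
    intro t
    have h1 : HasDerivAt (fun t : ℝ => x + t • h) h t := by
      simpa using ((hasDerivAt_id t).smul_const h).const_add x
    have h2 := (hφ (x + t • h)).hasGradientAt.hasFDerivAt.comp_hasDerivAt t h1
    have h3 := (hasDerivAt_id t).mul_const (inner ℝ (gradient φ x) h)
    have h4 := (((hasDerivAt_id t).pow 2).const_mul (L / 2)).mul_const (‖h‖ ^ 2)
    refine ((h2.sub h3).sub h4).congr_deriv ?_
    simp [inner_sub_left]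
    left
    ring
  have hanti : AntitoneOn
      (fun t : ℝ => φ (x + t • h) - t * inner ℝ (gradient φ x) h - L / 2 * t ^ 2 * ‖h‖ ^ 2)
      (Icc 0 1) := by
    apply antitoneOn_of_deriv_nonpos (convex_Icc 0 1)
    · exact fun t _ => (hd t).continuousAt.continuousWithinAt
    · exact fun t _ => (hd t).differentiableAt.differentiableWithinAt
    · intro t ht
      rw [interior_Icc] at ht
      rw [(hd t).deriv, sub_nonpos]
      calc inner ℝ (gradient φ (x + t • h) - gradient φ x) h
          ≤ ‖gradient φ (x + t • h) - gradient φ x‖ * ‖h‖ := real_inner_le_norm _ _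
        _ ≤ L * ‖x + t • h - x‖ * ‖h‖ := by gcongr; exact hlip _ _
        _ = L * t * ‖h‖ ^ 2 := by
          rw [add_sub_cancel_left, norm_smul, Real.norm_of_nonneg ht.1.le]; ring
  have := hanti (left_mem_Icc.2 zero_le_one) (right_mem_Icc.2 zero_le_one) zero_le_one
  simp only [one_smul, zero_smul, add_zero] at this
  linarith

/-- The squared gradient of a smooth function is controlled by its gap above a lower bound. -/
lemma norm_gradient_sq_le {φ : H → ℝ} {L m : ℝ} (hL : 0 < L) (hφ : Differentiable ℝ φ)
    (hlip : ∀ x y, ‖gradient φ x - gradient φ y‖ ≤ L * ‖x - y‖) (hm : ∀ x, m ≤ φ x) (x : H) :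
    ‖gradient φ x‖ ^ 2 ≤ 2 * L * (φ x - m) := by
  -- This displacement minimises the quadratic majorant of the descent lemma.
  have h := le_add_inner_gradient_add hφ hlip x (-(1 / L) • gradient φ x)
  rw [inner_smul_right, real_inner_self_eq_norm_sq, norm_smul, mul_pow, Real.norm_eq_abs,
    sq_abs] at h
  have h' := (hm _).trans h
  have e : φ x + -(1 / L) * ‖gradient φ x‖ ^ 2 + L / 2 * ((-(1 / L)) ^ 2 * ‖gradient φ x‖ ^ 2)
      = φ x - ‖gradient φ x‖ ^ 2 / (2 * L) := by field_simp; ring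
  rw [e] at h'
  have : ‖gradient φ x‖ ^ 2 / (2 * L) ≤ φ x - m := by linarith
  rw [div_le_iff₀ (by positivity)] at this
  linarith

end Smooth

/-! ### Expected excess under a polynomial tail. -/

section Tail

variable {α : Type*} [MeasurableSpace α] {Q : Measure α}

/-- A polynomial tail of order `p > 1` bounds the expected excess over a level. -/
lemma lintegral_sub_le_of_tail {W : α → ℝ} (hW : Measurable W) {a c p : ℝ} (ha : 0 < a)
    (hc : 0 ≤ c) (hp : 1 < p)
    (h : ∀ t, a ≤ t → Q {x | t < W x} ≤ ENNReal.ofReal (c * t ^ (-p))) :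
    ∫⁻ x, ENNReal.ofReal (W x - a) ∂Q ≤ ENNReal.ofReal (c * a ^ (1 - p) / (p - 1)) := by
  have e1 : ∀ x, ENNReal.ofReal (W x - a) = ENNReal.ofReal (max (W x - a) 0) := fun x => by
    rcases le_total (W x - a) 0 with h | h
    · rw [max_eq_right h, ENNReal.ofReal_of_nonpos h, ENNReal.ofReal_zero]
    · rw [max_eq_left h]
  simp_rw [e1]
  rw [lintegral_eq_lintegral_meas_lt Q (f := fun x => max (W x - a) 0)
    (Eventually.of_forall fun x => le_max_right _ _)
    ((hW.sub_const a).max measurable_const).aemeasurable]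
  -- The layer-cake integrand at t is the tail of W at level t + a. Its bound has an antiderivative
  -- that vanishes at infinity because p > 1.
  have hderiv : ∀ t ∈ Ici (0 : ℝ), HasDerivAt (fun t => -(c * (t + a) ^ (1 - p) / (p - 1)))
      (c * (t + a) ^ (-p)) t := by
    intro t ht
    have hta : 0 < t + a := add_pos_of_nonneg_of_pos ht ha
    have := (((((hasDerivAt_id t).add_const a).rpow_const (p := 1 - p)
      (Or.inl hta.ne')).const_mul c).div_const (p - 1)).neg
    refine this.congr_deriv ?_
    have : p - 1 ≠ 0 := by linarith
    simp only [id]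
    rw [show (1 - p - 1) = -p by ring]
    field_simp
    ring
  have hnn : ∀ t ∈ Ioi (0 : ℝ), 0 ≤ c * (t + a) ^ (-p) := fun t ht =>
    mul_nonneg hc (Real.rpow_nonneg (add_pos ht ha).le _)
  have hlim : Tendsto (fun t : ℝ => -(c * (t + a) ^ (1 - p) / (p - 1))) atTop (𝓝 0) := by
    have h1 : Tendsto (fun t : ℝ => (t + a) ^ (-(p - 1))) atTop (𝓝 0) :=
      (tendsto_rpow_neg_atTop (by linarith)).comp (tendsto_atTop_add_const_right _ a tendsto_id)
    simpa using ((h1.const_mul c).div_const (p - 1)).neg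
  calc ∫⁻ t in Ioi 0, Q {x | t < max (W x - a) 0}
      ≤ ∫⁻ t in Ioi 0, ENNReal.ofReal (c * (t + a) ^ (-p)) := by
        refine setLIntegral_mono' measurableSet_Ioi fun t ht => ?_
        refine (measure_mono fun x hx => ?_).trans (h (t + a) (by linarith [mem_Ioi.1 ht]))
        rcases lt_max_iff.1 (mem_ofPred.1 hx) with h | h
        · exact mem_ofPred.2 (by linarith)
        · exact absurd h (not_lt.2 (le_of_lt ht))
    _ = ENNReal.ofReal (c * a ^ (1 - p) / (p - 1)) := by
        rw [← ofReal_integral_eq_lintegral_ofReal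
          (integrableOn_Ioi_deriv_of_nonneg' hderiv hnn hlim)
          ((ae_restrict_mem measurableSet_Ioi).mono hnn),
          integral_Ioi_of_hasDerivAt_of_nonneg' hderiv hnn hlim]
        simp

end Tail

/-! ### Regularity of the objective, inherited from the samples. -/

section Objective

variable {Ξ : Type*} [MeasurableSpace Ξ] {d : ℕ} {P : Measure Ξ} {F : E d → Ξ → ℝ} {L σ p : ℝ}

/-- Each directional derivative is a limit of difference quotients, which are measurable in ξ; the
gradient is reassembled from its coordinates. -/
lemma measurable_sampleGrad (hm : ∀ x, Measurable (F x))
    (hd : ∀ ξ, Differentiable ℝ (fun x => F x ξ)) (x : E d) :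
    Measurable (fun ξ => sampleGrad F x ξ) := by
  have h1 : ∀ v : E d, Measurable (fun ξ => inner ℝ v (sampleGrad F x ξ)) := by
    intro v
    refine measurable_of_tendsto_metrizable
      (f := fun n : ℕ => fun ξ => ((n : ℝ) + 1) * (F (x + (((n : ℝ) + 1))⁻¹ • v) ξ - F x ξ))
      (fun n => ((hm _).sub (hm _)).const_mul _) ?_
    rw [tendsto_pi_nhds]
    intro ξ
    have h2 := (hd ξ x).hasGradientAt.hasFDerivAt.lim_real v
    have h3 := h2.comp (tendsto_atTop_add_const_right atTop (1 : ℝ) tendsto_natCast_atTop_atTop)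
    simpa [sampleGrad, real_inner_comm, Function.comp_def] using h3
  have h2 : (fun ξ => sampleGrad F x ξ) = fun ξ => ∑ i, inner ℝ
      (EuclideanSpace.basisFun (Fin d) ℝ i) (sampleGrad F x ξ) • EuclideanSpace.basisFun (Fin d) ℝ i := by
    ext1 ξ
    exact ((EuclideanSpace.basisFun (Fin d) ℝ).sum_repr' _).symm
  rw [h2]
  exact Finset.measurable_sum _ fun i _ => (h1 _).smul_const _

lemma integrable_of_weak_tail [IsFiniteMeasure P] (hp : 1 < p) {N : Ξ → E d} (hN : Measurable N)
    (h : ∀ t : ℝ, 0 < t → P {ξ | t < ‖N ξ‖} ≤ ENNReal.ofReal ((σ / t) ^ p)) (hσ : 0 ≤ σ) :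
    Integrable N P := by
  refine ⟨hN.aestronglyMeasurable, ?_⟩
  have h1 := lintegral_sub_le_of_tail (Q := P) hN.norm one_pos (Real.rpow_nonneg hσ p) hp
    (fun t ht => by
      have ht0 : 0 < t := lt_of_lt_of_le one_pos ht
      rw [Real.rpow_neg ht0.le, ← div_eq_mul_inv, ← Real.div_rpow hσ ht0.le]
      exact h t ht0)
  calc ∫⁻ ξ, ‖N ξ‖ₑ ∂P ≤ ∫⁻ ξ, (ENNReal.ofReal (‖N ξ‖ - 1) + 1) ∂P := by
        refine lintegral_mono fun ξ => ?_
        rw [← ofReal_norm, ← ENNReal.ofReal_one]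
        refine le_trans ?_ ENNReal.ofReal_add_le
        simp
    _ = ∫⁻ ξ, ENNReal.ofReal (‖N ξ‖ - 1) ∂P + P univ := by
        rw [lintegral_add_right _ measurable_const]; simp
    _ < ⊤ := ENNReal.add_lt_top.2 ⟨h1.trans_lt ENNReal.ofReal_lt_top, measure_lt_top _ _⟩

lemma Assumptions.measurable_noise (hA : Assumptions P F L σ p) (x : E d) :
    Measurable (fun ξ => sampleGrad F x ξ - gradient (objective P F) x) :=
  (measurable_sampleGrad hA.measurable hA.differentiable x).sub_const _

variable [IsProbabilityMeasure P]

/-- Differentiability of the objective is not yet known here, so its `gradient` might be the default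
value 0. This does no harm: a tail bound around any fixed vector gives integrability. -/
lemma Assumptions.integrable_sampleGrad (hA : Assumptions P F L σ p) (hp : 1 < p) (hσ : 0 ≤ σ)
    (x : E d) : Integrable (fun ξ => sampleGrad F x ξ) P := by
  have := (integrable_of_weak_tail hp (hA.measurable_noise x) (hA.weak_tail x) hσ).add
    (integrable_const (gradient (objective P F) x))
  exact this.congr (Eventually.of_forall fun ξ => by simp)

/-- The first-order remainder of almost every sample is at most L‖y - x‖², uniformly in ξ, so it
survives integration and is o(‖y - x‖). -/
lemma Assumptions.hasGradientAt (hA : Assumptions P F L σ p) (hp : 1 < p) (hσ : 0 ≤ σ)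
    (hL : 0 < L) (x : E d) :
    HasGradientAt (objective P F) (∫ ξ, sampleGrad F x ξ ∂P) x := by
  have hI := hA.integrable_sampleGrad hp hσ x
  have key : ∀ y, ‖objective P F y - objective P F x
      - inner ℝ (∫ ξ, sampleGrad F x ξ ∂P) (y - x)‖ ≤ L * ‖y - x‖ * ‖y - x‖ := by
    intro y
    have e : objective P F y - objective P F x - inner ℝ (∫ ξ, sampleGrad F x ξ ∂P) (y - x)
        = ∫ ξ, (F y ξ - F x ξ - inner ℝ (sampleGrad F x ξ) (y - x)) ∂P := by
      rw [integral_sub (f := fun ξ => F y ξ - F x ξ) ((hA.integrable y).sub (hA.integrable x))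
        (hI.inner_const _),
        integral_sub (hA.integrable y) (hA.integrable x)]
      congr 1
      rw [real_inner_comm, ← integral_inner hI]
      simp_rw [real_inner_comm (y - x)]
    rw [e]
    have := norm_integral_le_of_norm_le_const (μ := P)
      (f := fun ξ => F y ξ - F x ξ - inner ℝ (sampleGrad F x ξ) (y - x))
      (C := L * ‖y - x‖ * ‖y - x‖) (by
        filter_upwards [hA.sample_smooth] with ξ hξ
        exact abs_sub_sub_inner_gradient_le hL.le (hA.differentiable ξ) hξ le_rfl (by simp))
    simpa using this
  rw [hasGradientAt_iff_isLittleO]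
  refine Asymptotics.IsBigO.trans_isLittleO (g := fun y => ‖y - x‖ ^ 2) ?_ ?_
  · refine Asymptotics.IsBigO.of_bound L (Eventually.of_forall fun y => ?_)
    refine (key y).trans (le_of_eq ?_)
    simp; ring
  · have := (Asymptotics.isLittleO_norm_pow_id (E' := E d) one_lt_two).comp_tendsto
      (show Tendsto (fun y => y - x) (𝓝 x) (𝓝 0) by
        simpa using (continuous_id.sub continuous_const).tendsto x (f := fun y : E d => y - x))
    exact this

lemma Assumptions.gradient_objective (hA : Assumptions P F L σ p) (hp : 1 < p) (hσ : 0 ≤ σ)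
    (hL : 0 < L) (x : E d) :
    gradient (objective P F) x = ∫ ξ, sampleGrad F x ξ ∂P :=
  (hA.hasGradientAt hp hσ hL x).gradient

lemma Assumptions.objective_differentiable (hA : Assumptions P F L σ p) (hp : 1 < p) (hσ : 0 ≤ σ)
    (hL : 0 < L) : Differentiable ℝ (objective P F) :=
  fun x => (hA.hasGradientAt hp hσ hL x).differentiableAt

lemma Assumptions.objective_smooth (hA : Assumptions P F L σ p) (hp : 1 < p) (hσ : 0 ≤ σ)
    (hL : 0 < L) (x y : E d) :
    ‖gradient (objective P F) x - gradient (objective P F) y‖ ≤ L * ‖x - y‖ := by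
  rw [hA.gradient_objective hp hσ hL, hA.gradient_objective hp hσ hL,
    ← integral_sub (hA.integrable_sampleGrad hp hσ x) (hA.integrable_sampleGrad hp hσ y)]
  have := norm_integral_le_of_norm_le_const (μ := P)
    (f := fun ξ => sampleGrad F x ξ - sampleGrad F y ξ) (C := L * ‖x - y‖)
    (hA.sample_smooth.mono fun ξ h => h x y)
  simpa using this

end Objective

/-! ### Rotation invariance and moments of the uniform law on the sphere. -/

section Sphere

variable {d : ℕ}

instance unifSphere_isProbabilityMeasure [NeZero d] : IsProbabilityMeasure (unifSphere d) := by
  have : Nonempty (Fin d) := ⟨0⟩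
  refine ⟨?_⟩
  rw [unifSphere, Measure.smul_apply, smul_eq_mul]
  refine ENNReal.inv_mul_cancel ?_ (measure_ne_top _ _)
  rw [Ne, Measure.measure_univ_eq_zero]
  exact Measure.toSphere_ne_zero _

/-- The action of a linear isometry on the unit sphere. -/
def sphereMap (O : E d ≃ₗᵢ[ℝ] E d) (u : Sph d) : Sph d :=
  ⟨O u, by simp⟩

@[simp] lemma coe_sphereMap (O : E d ≃ₗᵢ[ℝ] E d) (u : Sph d) : (sphereMap O u : E d) = O u := rfl

lemma measurable_sphereMap (O : E d ≃ₗᵢ[ℝ] E d) : Measurable (sphereMap O) :=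
  (O.continuous.measurable.comp measurable_subtype_coe).subtype_mk

/-- The surface measure of a set is determined by the volume of the cone over it, and a linear
isometry preserves volume and commutes with forming cones. -/
lemma measurePreserving_sphereMap (O : E d ≃ₗᵢ[ℝ] E d) :
    MeasurePreserving (sphereMap O) (unifSphere d) (unifSphere d) := by
  have h : Measure.map (sphereMap O) (volume : Measure (E d)).toSphere
      = (volume : Measure (E d)).toSphere := by
    ext s hs
    rw [Measure.map_apply (measurable_sphereMap O) hs,
      Measure.toSphere_apply' _ (measurable_sphereMap O hs), Measure.toSphere_apply' _ hs]
    congr 1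
    rw [← O.measurePreserving.measure_preimage_equiv (f := O.toMeasurableEquiv)
      (Ioo (0 : ℝ) 1 • (Subtype.val '' s))]
    congr 1
    ext x
    simp only [mem_preimage, Set.mem_smul, mem_image]
    constructor
    · rintro ⟨r, hr, y, ⟨u, hu, rfl⟩, rfl⟩
      exact ⟨r, hr, O u, ⟨sphereMap O u, hu, rfl⟩, (map_smul O r _).symm⟩
    · rintro ⟨r, hr, y, ⟨u, hu, rfl⟩, h⟩
      refine ⟨r, hr, O.symm u, ⟨sphereMap O.symm u, ?_, rfl⟩, ?_⟩
      · have : sphereMap O (sphereMap O.symm u) = u := by ext1; simp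
        rw [this]; exact hu
      · apply O.injective
        rw [map_smul, O.apply_symm_apply]; exact h
  refine ⟨measurable_sphereMap O, ?_⟩
  rw [unifSphere, Measure.map_smul, h]

lemma integral_sphereMap (O : E d ≃ₗᵢ[ℝ] E d) {g : Sph d → ℝ} (hg : Measurable g) :
    ∫ u, g (sphereMap O u) ∂unifSphere d = ∫ u, g u ∂unifSphere d := by
  have h := (measurePreserving_sphereMap O).map_eq
  conv_rhs => rw [← h]
  rw [integral_map (measurable_sphereMap O).aemeasurable hg.aestronglyMeasurable]

/-- Two vectors of the same length are exchanged by a symmetric linear isometry. -/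
lemma exists_isometry_inner_eq {v w : E d} (h : ‖v‖ = ‖w‖) :
    ∃ O : E d ≃ₗᵢ[ℝ] E d, ∀ u : E d, inner ℝ w u = inner ℝ v (O u) := by
  refine ⟨(ℝ ∙ (v - w))ᗮ.reflection, fun u => ?_⟩
  have h1 := Submodule.reflection_sub h
  conv_lhs => rw [← h1]
  rw [← LinearIsometryEquiv.inner_map_map (ℝ ∙ (v - w))ᗮ.reflection v]
  rw [Submodule.reflection_reflection]

/-- A distinguished unit vector. -/
def unitVec (d : ℕ) [NeZero d] : E d := EuclideanSpace.single 0 1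

@[simp] lemma norm_unitVec [NeZero d] : ‖unitVec d‖ = 1 := by simp [unitVec]

lemma measurable_inner_sphere (v : E d) : Measurable (fun u : Sph d => inner ℝ v (u : E d)) :=
  (continuous_const.inner continuous_subtype_val).measurable

lemma abs_inner_sphere_le (v : E d) (u : Sph d) : |inner ℝ v (u : E d)| ≤ ‖v‖ := by
  have := abs_real_inner_le_norm v (u : E d)
  simpa using this

variable [NeZero d]

lemma integrable_of_bound_sphere {G : Type*} [NormedAddCommGroup G] [MeasurableSpace G]
    [BorelSpace G] [SecondCountableTopology G] {g : Sph d → G} (hg : Measurable g) (C : ℝ)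
    (h : ∀ u, ‖g u‖ ≤ C) : Integrable g (unifSphere d) :=
  Integrable.of_bound hg.aestronglyMeasurable C (Eventually.of_forall h)

/-- By rotation invariance the integral is ‖v‖² times a constant. Summing over an orthonormal basis
gives 1, so the constant is 1/d. -/
lemma integral_inner_sq (v : E d) :
    ∫ u : Sph d, inner ℝ v (u : E d) ^ 2 ∂unifSphere d = ‖v‖ ^ 2 / d := by
  have hmeas : ∀ w : E d, Measurable (fun u : Sph d => inner ℝ w (u : E d) ^ 2) := fun w =>
    (measurable_inner_sphere w).pow_const 2
  have hint : ∀ w : E d, Integrable (fun u : Sph d => inner ℝ w (u : E d) ^ 2) (unifSphere d) :=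
    fun w => integrable_of_bound_sphere (hmeas w) (‖w‖ ^ 2) fun u => by
      rw [norm_pow, Real.norm_eq_abs]
      exact pow_le_pow_left₀ (abs_nonneg _) (abs_inner_sphere_le w u) 2
  have heq : ∀ w : E d, ∫ u : Sph d, inner ℝ w (u : E d) ^ 2 ∂unifSphere d
      = ‖w‖ ^ 2 * ∫ u : Sph d, inner ℝ (unitVec d) (u : E d) ^ 2 ∂unifSphere d := by
    intro w
    obtain ⟨O, hO⟩ := exists_isometry_inner_eq (v := ‖w‖ • unitVec d) (w := w) (by
      simp [norm_smul])
    simp_rw [hO, ← coe_sphereMap]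
    rw [integral_sphereMap O (hmeas _), ← integral_const_mul]
    simp_rw [inner_smul_left, mul_pow]
    simp
  have hsum : ∑ i : Fin d, ∫ u : Sph d,
      inner ℝ (EuclideanSpace.basisFun (Fin d) ℝ i) (u : E d) ^ 2 ∂unifSphere d = 1 := by
    rw [← integral_finsetSum _ fun i _ => hint _]
    have : ∀ u : Sph d, ∑ i, inner ℝ (EuclideanSpace.basisFun (Fin d) ℝ i) (u : E d) ^ 2 = 1 := by
      intro u
      have := (EuclideanSpace.basisFun (Fin d) ℝ).sum_sq_norm_inner_right (u : E d)
      simpa using this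
    simp_rw [this]
    simp
  rw [heq v]
  simp_rw [heq (EuclideanSpace.basisFun (Fin d) ℝ _)] at hsum
  simp only [OrthonormalBasis.norm_eq_one, one_pow, one_mul, Finset.sum_const, Finset.card_univ,
    Fintype.card_fin, nsmul_eq_mul] at hsum
  have hd : (d : ℝ) ≠ 0 := Nat.cast_ne_zero.2 (NeZero.ne d)
  field_simp
  linear_combination ‖v‖ ^ 2 * hsum

lemma integral_inner_mul_inner (v w : E d) :
    ∫ u : Sph d, inner ℝ v (u : E d) * inner ℝ w (u : E d) ∂unifSphere d = inner ℝ v w / d := by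
  have hint : ∀ w : E d, Integrable (fun u : Sph d => inner ℝ w (u : E d) ^ 2) (unifSphere d) :=
    fun w => integrable_of_bound_sphere ((measurable_inner_sphere w).pow_const 2) (‖w‖ ^ 2)
      fun u => by
        rw [norm_pow, Real.norm_eq_abs]
        exact pow_le_pow_left₀ (abs_nonneg _) (abs_inner_sphere_le w u) 2
  have e : ∀ u : Sph d, inner ℝ v (u : E d) * inner ℝ w (u : E d)
      = (inner ℝ (v + w) (u : E d) ^ 2 - inner ℝ (v - w) (u : E d) ^ 2) / 4 := by
    intro u; rw [inner_add_left, inner_sub_left]; ring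
  simp_rw [e]
  rw [integral_div, integral_sub (hint _) (hint _), integral_inner_sq, integral_inner_sq,
    norm_add_sq_real, norm_sub_sq_real]
  ring

/-- Fractional moments of a coordinate of a uniform unit vector. -/
lemma lintegral_abs_inner_rpow_le {p : ℝ} (hp₀ : 0 ≤ p) (hp₂ : p ≤ 2) {e : E d} (he : ‖e‖ = 1) :
    ∫⁻ u : Sph d, ENNReal.ofReal (|inner ℝ e (u : E d)| ^ p) ∂unifSphere d
      ≤ ENNReal.ofReal ((1 / Real.sqrt d) ^ p) := by
  have hd : (0 : ℝ) < d := Nat.cast_pos.2 (NeZero.pos d)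
  -- Jensen in tangent-line form: s ↦ s^(p/2) is concave as p ≤ 2 and lies below its tangent at 1,
  -- and s = d⟨e,u⟩² has mean exactly 1.
  have hpt : ∀ u : Sph d, |inner ℝ e (u : E d)| ^ p
      ≤ (1 / Real.sqrt d) ^ p * (1 + p / 2 * (d * inner ℝ e (u : E d) ^ 2 - 1)) := by
    intro u
    set a : ℝ := inner ℝ e (u : E d)
    have h1 := _root_.rpow_one_add_le_one_add_mul_self (s := d * a ^ 2 - 1)
      (by nlinarith [sq_nonneg a]) (p := p / 2) (by linarith) (by linarith)
    have h2 : |a| ^ p = (1 / Real.sqrt d) ^ p * (1 + (d * a ^ 2 - 1)) ^ (p / 2) := by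
      have h3 : (1 + (d * a ^ 2 - 1)) ^ (p / 2) = (Real.sqrt d * |a|) ^ p := by
        rw [show 1 + (d * a ^ 2 - 1) = (Real.sqrt d * |a|) ^ (2 : ℝ) by
          rw [Real.rpow_two, mul_pow, Real.sq_sqrt hd.le, sq_abs]; ring,
          ← Real.rpow_mul (by positivity)]
        congr 1; ring
      rw [h3, ← Real.mul_rpow (by positivity) (by positivity), ← mul_assoc,
        one_div_mul_cancel (Real.sqrt_pos.2 hd).ne', one_mul]
    rw [h2]
    gcongr
  have hint : Integrable (fun u : Sph d => inner ℝ e (u : E d) ^ 2) (unifSphere d) :=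
    integrable_of_bound_sphere ((measurable_inner_sphere e).pow_const 2) (‖e‖ ^ 2)
      fun u => by
        rw [norm_pow, Real.norm_eq_abs]
        exact pow_le_pow_left₀ (abs_nonneg _) (abs_inner_sphere_le e u) 2
  have hint1 : Integrable (fun u : Sph d => p / 2 * (d * inner ℝ e (u : E d) ^ 2 - 1))
      (unifSphere d) := ((hint.const_mul _).sub (integrable_const _)).const_mul _
  have hint2 : Integrable (fun u : Sph d =>
      (1 / Real.sqrt d) ^ p * (1 + p / 2 * (d * inner ℝ e (u : E d) ^ 2 - 1))) (unifSphere d) :=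
    ((integrable_const _).add hint1).const_mul _
  calc ∫⁻ u : Sph d, ENNReal.ofReal (|inner ℝ e (u : E d)| ^ p) ∂unifSphere d
      ≤ ∫⁻ u : Sph d, ENNReal.ofReal ((1 / Real.sqrt d) ^ p
          * (1 + p / 2 * (d * inner ℝ e (u : E d) ^ 2 - 1))) ∂unifSphere d :=
        lintegral_mono fun u => ENNReal.ofReal_le_ofReal (hpt u)
    _ = ENNReal.ofReal (∫ u : Sph d, (1 / Real.sqrt d) ^ p
          * (1 + p / 2 * (d * inner ℝ e (u : E d) ^ 2 - 1)) ∂unifSphere d) := by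
        rw [ofReal_integral_eq_lintegral_ofReal hint2]
        exact Eventually.of_forall fun u => (Real.rpow_nonneg (abs_nonneg _) _).trans (hpt u)
    _ = ENNReal.ofReal ((1 / Real.sqrt d) ^ p) := by
        rw [integral_const_mul, integral_add (integrable_const _) hint1, integral_const_mul,
          integral_sub (hint.const_mul _) (integrable_const _), integral_const_mul,
          integral_inner_sq, he]
        simp [hd.ne']

end Sphere

/-! ### Projection of heavy-tailed noise on a random direction. -/

section Product

variable {d : ℕ} [NeZero d] {Ξ : Type*} [MeasurableSpace Ξ] {P : Measure Ξ}
  [IsProbabilityMeasure P]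

/-- The component of a heavy-tailed vector along an independent uniform direction has a tail of the
same order, with scale smaller by the factor `√d`. -/
lemma tail_inner_sphere {p σ : ℝ} (hp₁ : 1 < p) (hp₂ : p ≤ 2) (hσ : 0 ≤ σ) {N : Ξ → E d}
    (hN : Measurable N)
    (h : ∀ t : ℝ, 0 < t → P {ξ | t < ‖N ξ‖} ≤ ENNReal.ofReal ((σ / t) ^ p)) {s : ℝ} (hs : 0 < s) :
    ((unifSphere d).prod P) {z | s < |inner ℝ (N z.2) (z.1 : E d)|}
      ≤ ENNReal.ofReal ((σ / Real.sqrt d / s) ^ p) := by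
  have hm1 : MeasurableSet {z : Sph d × Ξ | s < |inner ℝ (N z.2) (z.1 : E d)|} := by
    refine measurableSet_lt measurable_const (Measurable.abs ?_)
    exact (hN.comp measurable_snd).inner (measurable_subtype_coe.comp measurable_fst)
  have hm2 : MeasurableSet {z : Sph d × Ξ | s < ‖N z.2‖ * |inner ℝ (unitVec d) (z.1 : E d)|} := by
    refine measurableSet_lt measurable_const (Measurable.mul ?_ (Measurable.abs ?_))
    · exact (hN.comp measurable_snd).norm
    · exact (measurable_inner_sphere _).comp measurable_fst
  -- For each fixed ξ, rotating u aligns the noise with one fixed axis. The norm and the direction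
  -- then factor, and the tail of the norm can be used for fixed u.
  have hrot : ((unifSphere d).prod P) {z | s < |inner ℝ (N z.2) (z.1 : E d)|}
      = ((unifSphere d).prod P) {z | s < ‖N z.2‖ * |inner ℝ (unitVec d) (z.1 : E d)|} := by
    rw [Measure.prod_apply_symm hm1, Measure.prod_apply_symm hm2]
    refine lintegral_congr fun ξ => ?_
    obtain ⟨O, hO⟩ := exists_isometry_inner_eq (v := ‖N ξ‖ • unitVec d) (w := N ξ) (by
      simp [norm_smul])
    have hms : MeasurableSet {u : Sph d | s < ‖N ξ‖ * |inner ℝ (unitVec d) (u : E d)|} :=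
      measurableSet_lt measurable_const ((measurable_inner_sphere _).abs.const_mul _)
    have := (measurePreserving_sphereMap O).measure_preimage hms.nullMeasurableSet
    refine Eq.trans ?_ this
    congr 1
    ext u
    simp only [mem_preimage, mem_ofPred_eq, coe_sphereMap, hO, inner_smul_left, abs_mul]
    simp
  rw [hrot, Measure.prod_apply hm2]
  calc ∫⁻ u, P (Prod.mk u ⁻¹' {z : Sph d × Ξ | s < ‖N z.2‖ * |inner ℝ (unitVec d) (z.1 : E d)|})
        ∂unifSphere d
      ≤ ∫⁻ u : Sph d, ENNReal.ofReal ((σ / s) ^ p)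
          * ENNReal.ofReal (|inner ℝ (unitVec d) (u : E d)| ^ p) ∂unifSphere d := by
        refine lintegral_mono fun u => ?_
        simp only [preimage_ofPred_eq]
        rcases (abs_nonneg (inner ℝ (unitVec d) (u : E d))).eq_or_lt with h0 | h0
        · simp [← h0, not_lt.2 hs.le]
        · rw [← ENNReal.ofReal_mul (by positivity), ← Real.mul_rpow (by positivity) (abs_nonneg _)]
          refine le_trans (measure_mono fun ξ hξ => ?_) ((h _ (div_pos hs h0)).trans_eq ?_)
          · exact mem_ofPred.2 ((div_lt_iff₀ h0).2 hξ)
          · congr 2; field_simp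
    _ = ENNReal.ofReal ((σ / s) ^ p)
          * ∫⁻ u : Sph d, ENNReal.ofReal (|inner ℝ (unitVec d) (u : E d)| ^ p) ∂unifSphere d :=
        lintegral_const_mul' _ _ ENNReal.ofReal_ne_top
    _ ≤ ENNReal.ofReal ((σ / s) ^ p) * ENNReal.ofReal ((1 / Real.sqrt d) ^ p) := by
        gcongr
        exact lintegral_abs_inner_rpow_le (by linarith) hp₂ norm_unitVec
    _ = ENNReal.ofReal ((σ / Real.sqrt d / s) ^ p) := by
        rw [← ENNReal.ofReal_mul (by positivity), ← Real.mul_rpow (by positivity) (by positivity)]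
        congr 2; field_simp

end Product

/-! ### Smoothing bias of the two-point estimator. -/

section Bias

variable {d : ℕ}

/-- The central difference quotient of an `L`-smooth function in a unit direction. -/
lemma abs_centralDiff_sub_inner_le {φ : E d → ℝ} {L μ : ℝ} (hL : 0 ≤ L) (hμ : 0 < μ)
    (hφ : Differentiable ℝ φ) (hlip : ∀ x y, ‖gradient φ x - gradient φ y‖ ≤ L * ‖x - y‖) (x : E d)
    (u : Sph d) :
    |(φ (x + μ • (u : E d)) - φ (x - μ • (u : E d))) / (2 * μ)
      - inner ℝ (gradient φ x) (u : E d)| ≤ L * μ := by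
  have h1 := abs_sub_sub_inner_gradient_le (x := x) (r := μ) (a := x + μ • (u : E d))
    (b := x - μ • (u : E d)) hL hφ hlip (by simp [norm_smul, abs_of_pos hμ])
    (by simp [norm_smul, abs_of_pos hμ])
  have hnorm : ‖(u : E d)‖ = 1 := by simp
  rw [show x + μ • (u : E d) - (x - μ • (u : E d)) = (2 * μ) • (u : E d) by module,
    norm_smul, Real.norm_of_nonneg (by positivity), inner_smul_right, hnorm] at h1
  rw [show (φ (x + μ • (u : E d)) - φ (x - μ • (u : E d))) / (2 * μ)
      - inner ℝ (gradient φ x) (u : E d) = (φ (x + μ • (u : E d)) - φ (x - μ • (u : E d))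
    - 2 * μ * inner ℝ (gradient φ x) (u : E d)) / (2 * μ) by field_simp,
    abs_div, abs_of_pos (by positivity : 0 < 2 * μ), div_le_iff₀ (by positivity)]
  linarith

variable [NeZero d]

/-- The two-point estimator of the gradient of an `L`-smooth function has bias at most `L μ`. -/
lemma norm_twoPoint_mean_sub_gradient_le {φ : E d → ℝ} {L μ : ℝ} (hL : 0 ≤ L) (hμ : 0 < μ)
    (hφ : Differentiable ℝ φ) (hlip : ∀ x y, ‖gradient φ x - gradient φ y‖ ≤ L * ‖x - y‖) (x : E d) :
    ‖(d : ℝ) • (∫ u : Sph d, ((φ (x + μ • (u : E d)) - φ (x - μ • (u : E d))) / (2 * μ)) • (u : E d)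
        ∂unifSphere d) - gradient φ x‖ ≤ L * μ := by
  have hd : (0 : ℝ) < d := Nat.cast_pos.2 (NeZero.pos d)
  set g := gradient φ x with hg
  set q : Sph d → ℝ := fun u => (φ (x + μ • (u : E d)) - φ (x - μ • (u : E d))) / (2 * μ) with hq
  have hqm : Measurable q := by
    have := hφ.continuous
    exact (by fun_prop : Continuous q).measurable
  have hnorm : ∀ u : Sph d, ‖(u : E d)‖ = 1 := fun u => by simp
  -- The linearisation error is Lμ-Lipschitz on the sphere, which is finer than its uniform bound
  -- Lμ; the uniform bound alone would leave a dimension factor in the bias.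
  have hdiff : ∀ u v : Sph d, |(q u - inner ℝ g (u : E d)) - (q v - inner ℝ g (v : E d))|
      ≤ L * μ * ‖(u : E d) - v‖ := by
    intro u v
    have h1 := abs_sub_sub_inner_gradient_le (x := x) (r := μ) (a := x + μ • (u : E d))
      (b := x + μ • (v : E d)) hL hφ hlip (by simp [norm_smul, abs_of_pos hμ])
      (by simp [norm_smul, abs_of_pos hμ])
    have h2 := abs_sub_sub_inner_gradient_le (x := x) (r := μ) (a := x - μ • (v : E d))
      (b := x - μ • (u : E d)) hL hφ hlip (by simp [norm_smul, abs_of_pos hμ])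
      (by simp [norm_smul, abs_of_pos hμ])
    rw [show x + μ • (u : E d) - (x + μ • (v : E d)) = μ • ((u : E d) - v) by module,
      norm_smul, Real.norm_of_nonneg hμ.le, inner_smul_right, ← hg] at h1
    rw [show x - μ • (v : E d) - (x - μ • (u : E d)) = μ • ((u : E d) - v) by module,
      norm_smul, Real.norm_of_nonneg hμ.le, inner_smul_right, ← hg] at h2
    have e : (q u - inner ℝ g (u : E d)) - (q v - inner ℝ g (v : E d))
        = ((φ (x + μ • (u : E d)) - φ (x + μ • (v : E d)) - μ * inner ℝ g ((u : E d) - v))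
          + (φ (x - μ • (v : E d)) - φ (x - μ • (u : E d)) - μ * inner ℝ g ((u : E d) - v)))
            / (2 * μ) := by
      simp only [hq]
      rw [inner_sub_right]
      field_simp
      ring
    rw [e, abs_div, abs_of_pos (by positivity : 0 < 2 * μ), div_le_iff₀ (by positivity)]
    refine (abs_add_le _ _).trans ((add_le_add h1 h2).trans (le_of_eq ?_))
    ring
  have hqb : ∀ u : Sph d, |q u| ≤ L * μ + ‖g‖ := by
    intro u
    have h2 : |q u - inner ℝ g (u : E d)| ≤ L * μ :=
      abs_centralDiff_sub_inner_le hL hμ hφ hlip x u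
    have h3 := abs_inner_sphere_le g u
    calc |q u| = |(q u - inner ℝ g (u : E d)) + inner ℝ g (u : E d)| := by ring_nf
      _ ≤ _ := (abs_add_le _ _).trans (add_le_add h2 h3)
  have hqu : Integrable (fun u : Sph d => q u • (u : E d)) (unifSphere d) :=
    integrable_of_bound_sphere (hqm.smul measurable_subtype_coe) (L * μ + ‖g‖) fun u => by
      rw [norm_smul, hnorm, mul_one]; exact hqb u
  set b := (d : ℝ) • (∫ u : Sph d, q u • (u : E d) ∂unifSphere d) - g with hb
  have hdir : ∀ e : E d, ‖e‖ = 1 → inner ℝ e b ≤ L * μ := by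
    intro e he
    set h : Sph d → ℝ := fun u => q u - inner ℝ g (u : E d) with hh
    have hhm : Measurable h := hqm.sub (measurable_inner_sphere g)
    have hhb : ∀ u, |h u| ≤ L * μ + ‖g‖ + ‖g‖ := fun u =>
      (abs_sub _ _).trans (add_le_add (hqb u) (abs_inner_sphere_le g u))
    have hbd : ∀ k : Sph d → ℝ, Measurable k → (∀ u, |k u| ≤ L * μ + ‖g‖ + ‖g‖) →
        Integrable (fun u : Sph d => k u * inner ℝ e (u : E d)) (unifSphere d) := by
      intro k hk hkb
      refine integrable_of_bound_sphere (hk.mul (measurable_inner_sphere e))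
        ((L * μ + ‖g‖ + ‖g‖) * ‖e‖) fun u => ?_
      rw [norm_mul]
      exact mul_le_mul (hkb u) (abs_inner_sphere_le e u) (norm_nonneg _)
        ((abs_nonneg _).trans (hkb u))
    -- The linear part of `q` reproduces g exactly, since d 𝔼[⟨g,u⟩⟨e,u⟩] = ⟨g,e⟩.
    have hbe : inner ℝ e b = d * ∫ u : Sph d, h u * inner ℝ e (u : E d) ∂unifSphere d := by
      have e1 : ∀ u : Sph d, h u * inner ℝ e (u : E d)
          = q u * inner ℝ e (u : E d) - inner ℝ g (u : E d) * inner ℝ e (u : E d) := fun u => by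
        simp only [hh]; ring
      simp_rw [e1]
      rw [integral_sub (hbd q hqm fun u => (hqb u).trans (by linarith [norm_nonneg g]))
        (hbd _ (measurable_inner_sphere g) fun u => (abs_inner_sphere_le g u).trans
          (by nlinarith [norm_nonneg g])), integral_inner_mul_inner, hb, inner_sub_right,
        inner_smul_right, ← integral_inner hqu]
      simp_rw [inner_smul_right]
      rw [real_inner_comm g e]
      field_simp
    -- Reflecting in the hyperplane orthogonal to e flips ⟨e,u⟩, so only the odd part of `h`
    -- contributes. As ‖u - Ru‖ = 2|⟨e,u⟩|, the Lipschitz bound produces ⟨e,u⟩², whose mean 1/d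
    -- cancels the factor d.
    set R : E d ≃ₗᵢ[ℝ] E d := (ℝ ∙ e)ᗮ.reflection with hR
    have hRu : ∀ u : E d, R u = u - (2 * inner ℝ e u) • e := by
      intro u
      rw [hR, Submodule.reflection_orthogonal_apply, Submodule.reflection_singleton_apply, he]
      simp
      module
    have hRe : ∀ u : Sph d, inner ℝ e (sphereMap R u : E d) = - inner ℝ e (u : E d) := by
      intro u
      rw [coe_sphereMap, hRu, inner_sub_right, inner_smul_right, real_inner_self_eq_norm_sq, he]
      ring
    have hswap : ∫ u : Sph d, h u * inner ℝ e (u : E d) ∂unifSphere d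
        = - ∫ u : Sph d, h (sphereMap R u) * inner ℝ e (u : E d) ∂unifSphere d := by
      rw [← integral_sphereMap R (g := fun u => h u * inner ℝ e (u : E d))
        (hhm.mul (measurable_inner_sphere e)), ← integral_neg]
      simp_rw [hRe]
      simp
    have hhR : Measurable fun u => h (sphereMap R u) := hhm.comp (measurable_sphereMap R)
    have h2 : 2 * ∫ u : Sph d, h u * inner ℝ e (u : E d) ∂unifSphere d
        = ∫ u : Sph d, (h u - h (sphereMap R u)) * inner ℝ e (u : E d) ∂unifSphere d := by
      simp_rw [sub_mul]
      rw [integral_sub (hbd h hhm hhb) (hbd _ hhR fun u => hhb _)]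
      linarith
    have h3 : ∫ u : Sph d, (h u - h (sphereMap R u)) * inner ℝ e (u : E d) ∂unifSphere d
        ≤ ∫ u : Sph d, 2 * (L * μ) * inner ℝ e (u : E d) ^ 2 ∂unifSphere d := by
      refine integral_mono ?_ ?_ fun u => ?_
      · simp_rw [sub_mul]
        exact (hbd h hhm hhb).sub (hbd _ hhR fun u => hhb _)
      · refine integrable_of_bound_sphere (((measurable_inner_sphere e).pow_const 2).const_mul _)
          (2 * (L * μ) * 1) fun u => ?_
        rw [norm_mul, norm_pow, Real.norm_of_nonneg (by positivity)]
        gcongr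
        have := abs_inner_sphere_le e u
        rw [he] at this
        exact pow_le_one₀ (norm_nonneg _) this
      · have h4 := hdiff u (sphereMap R u)
        rw [coe_sphereMap, hRu, sub_sub_cancel, norm_smul, he, mul_one, norm_mul,
          Real.norm_eq_abs, Real.norm_eq_abs, abs_two] at h4
        calc (h u - h (sphereMap R u)) * inner ℝ e (u : E d)
            ≤ |h u - h (sphereMap R u)| * |inner ℝ e (u : E d)| := by
              rw [← abs_mul]; exact le_abs_self _
          _ ≤ L * μ * (2 * |inner ℝ e (u : E d)|) * |inner ℝ e (u : E d)| := by
              gcongr; simpa [hh, hRu] using h4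
          _ = 2 * (L * μ) * inner ℝ e (u : E d) ^ 2 := by rw [← sq_abs]; ring
    rw [integral_const_mul, integral_inner_sq, he] at h3
    rw [hbe]
    have h5 : ∫ u : Sph d, h u * inner ℝ e (u : E d) ∂unifSphere d ≤ L * μ * (1 ^ 2 / d) := by
      linarith
    calc (d : ℝ) * ∫ u : Sph d, h u * inner ℝ e (u : E d) ∂unifSphere d
        ≤ d * (L * μ * (1 ^ 2 / d)) := by gcongr
      _ = L * μ := by field_simp
  rcases eq_or_ne b 0 with h0 | h0
  · rw [h0, norm_zero]; positivity
  · have := hdir (‖b‖⁻¹ • b) (by rw [norm_smul, norm_inv, norm_norm, inv_mul_cancel₀ (by simpa)])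
    rwa [inner_smul_left, real_inner_self_eq_norm_sq, sq, RCLike.conj_to_real, ← mul_assoc,
      inv_mul_cancel₀ (by simpa), one_mul] at this

end Bias

/-! ### Bernstein inequality in Hilbert space through cosh of the norm. -/

section Bernstein

variable {H : Type*} [NormedAddCommGroup H] [InnerProductSpace ℝ H]

/-- `y ↦ cosh √y` is convex on the nonnegative half-line. -/
lemma convexOn_cosh_sqrt : ConvexOn ℝ (Ici 0) (fun y : ℝ => Real.cosh (Real.sqrt y)) := by
  -- The power series in y has nonnegative coefficients, so convexity holds term by term.
  have hsum : ∀ y ∈ Ici (0 : ℝ),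
      HasSum (fun n : ℕ => y ^ n / ((2 * n).factorial : ℝ)) (Real.cosh (Real.sqrt y)) := by
    intro y hy
    have := Real.hasSum_cosh (Real.sqrt y)
    simpa [pow_mul, Real.sq_sqrt (mem_Ici.1 hy)] using this
  refine ⟨convex_Ici 0, fun x hx y hy a b ha hb hab => ?_⟩
  have hxy : a • x + b • y ∈ Ici (0 : ℝ) := convex_Ici 0 hx hy ha hb hab
  refine hasSum_le (fun n => ?_) (hsum _ hxy)
    (((hsum x hx).mul_left a).add ((hsum y hy).mul_left b))
  have := (convexOn_pow n).2 hx hy ha hb hab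
  simp only [smul_eq_mul] at this ⊢
  calc (a * x + b * y) ^ n / ((2 * n).factorial : ℝ)
      ≤ (a * x ^ n + b * y ^ n) / ((2 * n).factorial : ℝ) := by gcongr
    _ = _ := by ring

/-- The norm of a sum is interpolated between the two collinear cases. -/
lemma cosh_norm_add_le {s h : H} (hs : s ≠ 0) (hh : h ≠ 0) :
    Real.cosh ‖s + h‖ ≤ Real.cosh ‖s‖ * Real.cosh ‖h‖
      + Real.sinh ‖s‖ * Real.sinh ‖h‖ * (inner ℝ s h / (‖s‖ * ‖h‖)) := by
  set a := ‖s‖ with ha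
  set b := ‖h‖ with hb
  have ha0 : 0 < a := norm_pos_iff.2 hs
  have hb0 : 0 < b := norm_pos_iff.2 hh
  set c : ℝ := inner ℝ s h / (a * b) with hc
  have hcabs : |c| ≤ 1 := abs_real_inner_div_norm_mul_norm_le_one s h
  have hc1 := abs_le.1 hcabs
  have hin : inner ℝ s h = a * b * c := by rw [hc]; field_simp
  -- With c the cosine of the angle, ‖s + h‖² is the average of (a + b)² and (a - b)² with weights
  -- (1 ± c)/2.
  have hconv := convexOn_cosh_sqrt.2 (mem_Ici.2 (sq_nonneg (a + b))) (mem_Ici.2 (sq_nonneg (a - b)))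
    (show 0 ≤ (1 + c) / 2 by linarith) (show 0 ≤ (1 - c) / 2 by linarith) (by ring)
  simp only [smul_eq_mul] at hconv
  have e : (1 + c) / 2 * (a + b) ^ 2 + (1 - c) / 2 * (a - b) ^ 2 = ‖s + h‖ ^ 2 := by
    rw [norm_add_sq_real, hin, ← ha, ← hb]; ring
  rw [e, Real.sqrt_sq (norm_nonneg _), Real.sqrt_sq_eq_abs, Real.sqrt_sq_eq_abs, Real.cosh_abs,
    Real.cosh_abs, Real.cosh_add, Real.cosh_sub] at hconv
  refine hconv.trans (le_of_eq ?_)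
  ring

/-- A pointwise form of Pinelis' inequality: up to a term linear in `h`, adding a short vector `h`
multiplies `cosh ‖·‖` by at most `1 + ‖h‖²`. -/
lemma exists_cosh_norm_add_le (s : H) : ∃ v : H, ∀ h : H, ‖h‖ ≤ 1 →
    Real.cosh ‖s + h‖ ≤ Real.cosh ‖s‖ * (1 + ‖h‖ ^ 2) + inner ℝ v h := by
  have hexp : ∀ b : ℝ, 0 ≤ b → b ≤ 1 → Real.exp b ≤ 1 + b + b ^ 2 := by
    intro b h0 h1
    have := (abs_le.1 (Real.abs_exp_sub_one_sub_id_le (x := b) (abs_le.2 ⟨by linarith, h1⟩))).2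
    linarith
  -- This is the gradient of cosh ‖·‖ at s, equal to 0 for s = 0. After removing the linear term,
  -- the growth factor is at most cosh b + (sinh b - b) = exp b - b ≤ 1 + b².
  refine ⟨(Real.sinh ‖s‖ / ‖s‖) • s, fun h h1 => ?_⟩
  set b := ‖h‖ with hb
  have hb0 : 0 ≤ b := norm_nonneg _
  have hes : Real.cosh b + Real.sinh b = Real.exp b := Real.cosh_add_sinh b
  have hsb : b ≤ Real.sinh b := Real.self_le_sinh_iff.2 hb0
  have hE := hexp b hb0 h1
  have hch : Real.cosh b ≤ 1 + b ^ 2 := by linarith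
  rcases eq_or_ne s 0 with rfl | hs
  · simp only [zero_add, norm_zero, Real.cosh_zero, one_mul, smul_zero, inner_zero_left, add_zero]
    exact hch
  rcases eq_or_ne h 0 with rfl | hh
  · simp [hb]
  have hb1 : 0 < b := norm_pos_iff.2 hh
  have ha1 : 0 < ‖s‖ := norm_pos_iff.2 hs
  refine (cosh_norm_add_le hs hh).trans ?_
  have hc := abs_real_inner_div_norm_mul_norm_le_one s h
  rw [inner_smul_left, RCLike.conj_to_real]
  set c : ℝ := inner ℝ s h / (‖s‖ * ‖h‖) with hcdef
  have hin : Real.sinh ‖s‖ / ‖s‖ * inner ℝ s h = Real.sinh ‖s‖ * b * c := by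
    rw [hcdef, ← hb]; field_simp
  rw [hin, ← hb]
  have hsh : 0 ≤ Real.sinh ‖s‖ := Real.sinh_nonneg_iff.2 ha1.le
  have hlt : Real.sinh ‖s‖ ≤ Real.cosh ‖s‖ := (Real.sinh_lt_cosh _).le
  have h2 : Real.sinh ‖s‖ * ((Real.sinh b - b) * c) ≤ Real.cosh ‖s‖ * (Real.sinh b - b) := by
    have h3 : (Real.sinh b - b) * c ≤ Real.sinh b - b :=
      mul_le_of_le_one_right (by linarith) (abs_le.1 hc).2
    calc Real.sinh ‖s‖ * ((Real.sinh b - b) * c) ≤ Real.sinh ‖s‖ * (Real.sinh b - b) := by gcongr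
      _ ≤ _ := by gcongr
  have h4 : Real.cosh ‖s‖ * (Real.cosh b + (Real.sinh b - b)) ≤ Real.cosh ‖s‖ * (1 + b ^ 2) :=
    mul_le_mul_of_nonneg_left (by linarith) (Real.cosh_pos ‖s‖).le
  linarith

variable [CompleteSpace H] [MeasurableSpace H] [BorelSpace H] [SecondCountableTopology H]
variable {α : Type*} [MeasurableSpace α] {Q : Measure α} [IsProbabilityMeasure Q]

/-- Centering kills the linear term of the pointwise inequality, leaving the factor 1 + 𝔼‖X‖² ≤ exp
V. -/
lemma lintegral_cosh_norm_add_le {X : α → H} (hX : Measurable X) (hb : ∀ z, ‖X z‖ ≤ 1)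
    (h0 : ∫ z, X z ∂Q = 0) {V : ℝ} (hV : ∫ z, ‖X z‖ ^ 2 ∂Q ≤ V) (s : H) :
    ∫⁻ z, ENNReal.ofReal (Real.cosh ‖s + X z‖) ∂Q
      ≤ ENNReal.ofReal (Real.cosh ‖s‖ * Real.exp V) := by
  obtain ⟨v, hv⟩ := exists_cosh_norm_add_le s
  have hXi : Integrable X Q := Integrable.of_bound hX.aestronglyMeasurable 1
    (Eventually.of_forall hb)
  have hX2 : Integrable (fun z => ‖X z‖ ^ 2) Q :=
    Integrable.of_bound (hX.norm.pow_const 2).aestronglyMeasurable 1 (Eventually.of_forall fun z => by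
      rw [norm_pow, norm_norm]; exact pow_le_one₀ (norm_nonneg _) (hb z))
  have hI1 : Integrable (fun z => 1 + ‖X z‖ ^ 2) Q := (integrable_const _).add hX2
  have hI : Integrable (fun z => Real.cosh ‖s‖ * (1 + ‖X z‖ ^ 2) + inner ℝ v (X z)) Q :=
    (hI1.const_mul _).add (hXi.const_inner v)
  calc ∫⁻ z, ENNReal.ofReal (Real.cosh ‖s + X z‖) ∂Q
      ≤ ∫⁻ z, ENNReal.ofReal (Real.cosh ‖s‖ * (1 + ‖X z‖ ^ 2) + inner ℝ v (X z)) ∂Q :=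
        lintegral_mono fun z => ENNReal.ofReal_le_ofReal (hv _ (hb z))
    _ = ENNReal.ofReal (∫ z, (Real.cosh ‖s‖ * (1 + ‖X z‖ ^ 2) + inner ℝ v (X z)) ∂Q) := by
        rw [ofReal_integral_eq_lintegral_ofReal hI]
        exact Eventually.of_forall fun z => (Real.cosh_pos _).le.trans (hv _ (hb z))
    _ = ENNReal.ofReal (Real.cosh ‖s‖ * (1 + ∫ z, ‖X z‖ ^ 2 ∂Q)) := by
        rw [integral_add (hI1.const_mul _) (hXi.const_inner v), integral_const_mul,
          integral_add (integrable_const _) hX2, integral_inner hXi, h0]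
        simp
    _ ≤ ENNReal.ofReal (Real.cosh ‖s‖ * Real.exp V) := by
        have := Real.cosh_pos ‖s‖
        gcongr
        have := Real.add_one_le_exp V
        linarith

lemma lintegral_pi_cosh_norm_sum_le {X : α → H} (hX : Measurable X) (hb : ∀ z, ‖X z‖ ≤ 1)
    (h0 : ∫ z, X z ∂Q = 0) {V : ℝ} (hV : ∫ z, ‖X z‖ ^ 2 ∂Q ≤ V) (n : ℕ) (s : H) :
    ∫⁻ z : Fin n → α, ENNReal.ofReal (Real.cosh ‖s + ∑ i, X (z i)‖) ∂(Measure.pi fun _ => Q)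
      ≤ ENNReal.ofReal (Real.cosh ‖s‖ * Real.exp (n * V)) := by
  -- The starting vector must vary: with the first sample frozen, the others form a shorter sum
  -- started at s + X.
  induction n generalizing s with
  | zero => simp
  | succ n ih =>
    have hmp := (measurePreserving_piFinSuccAbove (fun _ : Fin (n + 1) => Q) 0).symm
    have hmeas : ∀ m : ℕ, Measurable fun z : Fin m → α =>
        ENNReal.ofReal (Real.cosh ‖s + ∑ i, X (z i)‖) := by
      intro m
      have : Measurable fun z : Fin m → α => s + ∑ i, X (z i) :=
        measurable_const.add (Finset.measurable_sum _ fun i _ => hX.comp (measurable_pi_apply i))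
      exact (Real.measurable_cosh.comp this.norm).ennreal_ofReal
    rw [← hmp.lintegral_comp (hmeas _)]
    have hm2 : Measurable fun z : α × (Fin n → α) =>
        ENNReal.ofReal (Real.cosh ‖s + X z.1 + ∑ i, X (z.2 i)‖) := by
      have : Measurable fun z : α × (Fin n → α) => s + X z.1 + ∑ i, X (z.2 i) :=
        (measurable_const.add (hX.comp measurable_fst)).add
          (Finset.measurable_sum _ fun i _ => hX.comp ((measurable_pi_apply i).comp measurable_snd))
      exact (Real.measurable_cosh.comp this.norm).ennreal_ofReal
    calc _ = ∫⁻ z : α × (Fin n → α), ENNReal.ofReal (Real.cosh ‖s + X z.1 + ∑ i, X (z.2 i)‖)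
          ∂(Q.prod (Measure.pi fun _ => Q)) := by
          refine lintegral_congr fun z => ?_
          rw [Fin.sum_univ_succ, ← add_assoc]
          simp [MeasurableEquiv.piFinSuccAbove]
      _ = ∫⁻ x, ∫⁻ z : Fin n → α, ENNReal.ofReal (Real.cosh ‖s + X x + ∑ i, X (z i)‖)
          ∂(Measure.pi fun _ => Q) ∂Q := lintegral_prod _ hm2.aemeasurable
      _ ≤ ∫⁻ x, ENNReal.ofReal (Real.cosh ‖s + X x‖) * ENNReal.ofReal (Real.exp (n * V)) ∂Q := by
          refine lintegral_mono fun x => ?_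
          rw [← ENNReal.ofReal_mul (Real.cosh_pos _).le]
          exact ih _
      _ = (∫⁻ x, ENNReal.ofReal (Real.cosh ‖s + X x‖) ∂Q) * ENNReal.ofReal (Real.exp (n * V)) :=
          lintegral_mul_const' _ _ ENNReal.ofReal_ne_top
      _ ≤ ENNReal.ofReal (Real.cosh ‖s‖ * Real.exp V) * ENNReal.ofReal (Real.exp (n * V)) := by
          gcongr
          exact lintegral_cosh_norm_add_le hX hb h0 hV s
      _ = ENNReal.ofReal (Real.cosh ‖s‖ * Real.exp ((n + 1 : ℕ) * V)) := by
          rw [← ENNReal.ofReal_mul (by positivity), mul_assoc, ← Real.exp_add]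
          congr 3; push_cast; ring

/-- A dimension-free Bernstein inequality for sums of independent bounded centered vectors. -/
lemma pi_norm_sum_gt_le {X : α → H} (hX : Measurable X) {lam : ℝ} (hlam : 0 < lam)
    (hb : ∀ z, lam * ‖X z‖ ≤ 1) (h0 : ∫ z, X z ∂Q = 0) {V : ℝ} (hV : ∫ z, ‖X z‖ ^ 2 ∂Q ≤ V)
    (n : ℕ) (r : ℝ) :
    (Measure.pi fun _ : Fin n => Q) {z | r < ‖∑ i, X (z i)‖}
      ≤ ENNReal.ofReal (2 * Real.exp (n * (lam ^ 2 * V) - lam * r)) := by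
  have h1 := lintegral_pi_cosh_norm_sum_le (Q := Q) (X := fun z => lam • X z) (hX.const_smul lam)
    (fun z => by rw [norm_smul, Real.norm_of_nonneg hlam.le]; exact hb z)
    (by rw [integral_smul, h0, smul_zero]) (V := lam ^ 2 * V) (by
      simp_rw [norm_smul, Real.norm_of_nonneg hlam.le, mul_pow]
      rw [integral_const_mul]; gcongr) n 0
  simp only [zero_add, norm_zero, Real.cosh_zero, one_mul, ← Finset.smul_sum, norm_smul,
    Real.norm_of_nonneg hlam.le] at h1
  have hmeas : Measurable fun z : Fin n → α =>
      ENNReal.ofReal (Real.cosh (lam * ‖∑ i, X (z i)‖)) := by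
    have : Measurable fun z : Fin n → α => ∑ i, X (z i) :=
      Finset.measurable_sum _ fun i _ => hX.comp (measurable_pi_apply i)
    exact (Real.measurable_cosh.comp (this.norm.const_mul lam)).ennreal_ofReal
  -- Markov's inequality with cosh y ≥ exp y / 2, the source of the factor 2.
  have hpos : 0 < Real.exp (lam * r) / 2 := by positivity
  have h2 := mul_meas_ge_le_lintegral₀ (μ := Measure.pi fun _ : Fin n => Q) hmeas.aemeasurable
    (ENNReal.ofReal (Real.exp (lam * r) / 2))
  have h3 : (Measure.pi fun _ : Fin n => Q) {z | r < ‖∑ i, X (z i)‖}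
      ≤ (Measure.pi fun _ : Fin n => Q) {z | ENNReal.ofReal (Real.exp (lam * r) / 2)
        ≤ ENNReal.ofReal (Real.cosh (lam * ‖∑ i, X (z i)‖))} := by
    refine measure_mono fun z hz => ?_
    refine mem_ofPred.2 (ENNReal.ofReal_le_ofReal ?_)
    rw [Real.cosh_eq]
    have : Real.exp (lam * r) ≤ Real.exp (lam * ‖∑ i, X (z i)‖) := by
      have : r < ‖∑ i, X (z i)‖ := hz
      gcongr
    have := Real.exp_pos (-(lam * ‖∑ i, X (z i)‖))
    linarith
  refine h3.trans ?_
  have h4 := (ENNReal.le_div_iff_mul_le (Or.inl (ENNReal.ofReal_pos.2 hpos).ne')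
    (Or.inl ENNReal.ofReal_ne_top)).2 ((mul_comm _ _).trans_le (h2.trans h1))
  refine h4.trans (le_of_eq ?_)
  rw [← ENNReal.ofReal_div_of_pos hpos, Real.exp_sub]
  congr 1
  field_simp

end Bernstein

/-! ### Second moment of a truncated heavy-tailed variable. -/

section Truncation

variable {α : Type*} [MeasurableSpace α] {Q : Measure α} [IsProbabilityMeasure Q]

/-- Second moment of a truncated variable with a tail of order `p ≤ 2`. -/
lemma integral_min_sq_le_of_tail {W : α → ℝ} (hW : Measurable W) (hW0 : ∀ x, 0 ≤ W x)
    {a b c p : ℝ} (ha : 0 < a) (hab : a ≤ b) (hc : 0 ≤ c) (hp : p ≤ 2)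
    (h : ∀ t, a ≤ t → Q {x | t < W x} ≤ ENNReal.ofReal (c * t ^ (-p))) :
    ∫ x, min (W x) b ^ 2 ∂Q ≤ a ^ 2 + 2 * c * b ^ (2 - p) * Real.log (b / a) := by
  have hb : 0 < b := ha.trans_le hab
  set K := 2 * c * b ^ (2 - p) with hK
  have hK0 : 0 ≤ K := by positivity
  have hlog : 0 ≤ Real.log (b / a) := Real.log_nonneg ((one_le_div ha).2 hab)
  have hm : Measurable fun x => min (W x) b := hW.min measurable_const
  have hm0 : ∀ x, 0 ≤ min (W x) b := fun x => le_min (hW0 x) hb.le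
  have hcake := lintegral_comp_eq_lintegral_meas_lt_mul Q (f := fun x => min (W x) b)
    (g := fun t => 2 * t) (Eventually.of_forall hm0) hm.aemeasurable
    (fun t _ => (by fun_prop : Continuous fun t : ℝ => 2 * t).intervalIntegrable _ _)
    ((ae_restrict_mem measurableSet_Ioi).mono fun t ht => by
      have : (0 : ℝ) < t := ht
      positivity)
  have hsq : ∀ y : ℝ, ∫ t in (0 : ℝ)..y, 2 * t = y ^ 2 := by
    intro y
    rw [intervalIntegral.integral_const_mul, integral_id]; ring
  simp_rw [hsq] at hcake
  have h1 : ∫⁻ t in Ioc 0 a, Q {x | t < min (W x) b} * ENNReal.ofReal (2 * t)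
      ≤ ENNReal.ofReal (a ^ 2) := by
    calc _ ≤ ∫⁻ t in Ioc 0 a, ENNReal.ofReal (2 * t) := by
          refine lintegral_mono fun t => ?_
          exact mul_le_of_le_one_left zero_le prob_le_one
      _ = ENNReal.ofReal (a ^ 2) := by
          rw [← ofReal_integral_eq_lintegral_ofReal, ← intervalIntegral.integral_of_le ha.le, hsq]
          · exact ((by fun_prop : Continuous fun t : ℝ => 2 * t).intervalIntegrable 0 a).1
          · refine (ae_restrict_mem measurableSet_Ioc).mono fun t ht => ?_
            have : (0 : ℝ) < t := ht.1
            simp only [Pi.zero_apply]; positivity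
  have h2 : ∫⁻ t in Ioc a b, Q {x | t < min (W x) b} * ENNReal.ofReal (2 * t)
      ≤ ENNReal.ofReal (K * Real.log (b / a)) := by
    calc _ ≤ ∫⁻ t in Ioc a b, ENNReal.ofReal (K * t⁻¹) := by
          refine setLIntegral_mono' measurableSet_Ioc fun t ht => ?_
          have ht0 : 0 < t := ha.trans ht.1
          have h3 : Q {x | t < min (W x) b} ≤ ENNReal.ofReal (c * t ^ (-p)) :=
            (measure_mono fun x (hx : t < min (W x) b) => (lt_min_iff.1 hx).1).trans (h t ht.1.le)
          refine (mul_le_mul_left h3 _).trans ?_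
          rw [← ENNReal.ofReal_mul (by positivity)]
          refine ENNReal.ofReal_le_ofReal ?_
          -- Trading t^(1-p) for b^(2-p)/t costs a logarithm but avoids the factor 1/(2-p), so the
          -- bound stays valid at p = 2. This logarithm becomes the square-root factor in `eta`.
          have h4 : t ^ (2 - p) ≤ b ^ (2 - p) := Real.rpow_le_rpow ht0.le ht.2 (by linarith)
          have h5 : t ^ (-p) * t = t ^ (2 - p) * t⁻¹ := by
            rw [← Real.rpow_add_one ht0.ne', ← Real.rpow_neg_one t, ← Real.rpow_add ht0]
            congr 1; ring
          calc c * t ^ (-p) * (2 * t) = 2 * c * (t ^ (2 - p) * t⁻¹) := by rw [← h5]; ring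
            _ ≤ 2 * c * (b ^ (2 - p) * t⁻¹) := by gcongr
            _ = K * t⁻¹ := by rw [hK]; ring
      _ = ENNReal.ofReal (K * Real.log (b / a)) := by
          have hii : IntervalIntegrable (fun t : ℝ => K * t⁻¹) volume a b := by
            refine (intervalIntegral.intervalIntegrable_inv (fun t ht => ?_)
              continuousOn_id).const_mul K
            rw [uIcc_of_le hab] at ht
            exact (ha.trans_le ht.1).ne'
          rw [← ofReal_integral_eq_lintegral_ofReal hii.1, ← intervalIntegral.integral_of_le hab,
            intervalIntegral.integral_const_mul, integral_inv_of_pos ha hb]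
          refine (ae_restrict_mem measurableSet_Ioc).mono fun t ht => ?_
          have : (0 : ℝ) < t := ha.trans ht.1
          simp only [Pi.zero_apply]; positivity
  have h3 : ∫⁻ t in Ioi b, Q {x | t < min (W x) b} * ENNReal.ofReal (2 * t) = 0 := by
    rw [setLIntegral_congr_fun (g := fun _ => 0) measurableSet_Ioi]
    · simp
    · intro t ht
      have : {x | t < min (W x) b} = ∅ := by
        ext x
        simp only [mem_ofPred_eq, mem_empty_iff_false, iff_false, not_lt]
        exact (min_le_right _ _).trans (le_of_lt ht)
      simp only [this, measure_empty, zero_mul]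
  have htot : ∫⁻ x, ENNReal.ofReal (min (W x) b ^ 2) ∂Q
      ≤ ENNReal.ofReal (a ^ 2 + K * Real.log (b / a)) := by
    rw [hcake, ← Ioc_union_Ioi_eq_Ioi ha.le, ← Ioc_union_Ioi_eq_Ioi hab,
      ENNReal.ofReal_add (by positivity) (by positivity)]
    refine (lintegral_union_le _ _ _).trans (add_le_add h1 ?_)
    refine (lintegral_union_le _ _ _).trans ?_
    rw [h3, add_zero]
    exact h2
  rw [integral_eq_lintegral_of_nonneg_ae (Eventually.of_forall fun x => sq_nonneg _)
    (hm.pow_const 2).aestronglyMeasurable]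
  exact ENNReal.toReal_le_of_le_ofReal (by positivity) htot

end Truncation

/-! ### Measurability and tail of the two-point estimate. -/

section TwoPoint

variable {Ξ : Type*} [MeasurableSpace Ξ] {d : ℕ} {P : Measure Ξ} {F : E d → Ξ → ℝ}
  {L σ p μ Δ₀ : ℝ}

/-- F is a Carathéodory function: continuous in x and measurable in ξ. -/
lemma Assumptions.measurable_uncurry (hA : Assumptions P F L σ p) :
    Measurable fun z : E d × Ξ => F z.1 z.2 :=
  measurable_uncurry_of_continuous_of_measurable (fun ξ => (hA.differentiable ξ).continuous)
    hA.measurable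

lemma Assumptions.measurable_twoPoint (hA : Assumptions P F L σ p) (μ : ℝ) :
    Measurable fun z : E d × Sph d × Ξ => twoPoint F μ z.1 z.2.1 z.2.2 := by
  have hu : Measurable fun z : E d × Sph d × Ξ => μ • (z.2.1 : E d) :=
    (measurable_subtype_coe.comp (measurable_fst.comp measurable_snd)).const_smul μ
  have hx : Measurable fun z : E d × Sph d × Ξ => z.1 := measurable_fst
  have hξ : Measurable fun z : E d × Sph d × Ξ => z.2.2 := measurable_snd.comp measurable_snd
  exact ((hA.measurable_uncurry.comp ((hx.add hu).prodMk hξ)).sub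
    (hA.measurable_uncurry.comp ((hx.sub hu).prodMk hξ))).div_const _

lemma ae_abs_twoPoint_sub_inner_le (hA : Assumptions P F L σ p) (hL : 0 < L) (hμ : 0 < μ)
    (x : E d) : ∀ᵐ z ∂(unifSphere d).prod P,
      |twoPoint F μ x z.1 z.2 - inner ℝ (sampleGrad F x z.2) (z.1 : E d)| ≤ L * μ := by
  have h := Measure.quasiMeasurePreserving_snd (μ := unifSphere d) (ν := P)
  filter_upwards [h.ae hA.sample_smooth] with z hz
  exact abs_centralDiff_sub_inner_le hL.le hμ (hA.differentiable z.2) hz x z.1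

variable [NeZero d] [IsProbabilityMeasure P]

/-- Tail of the two-point estimate at a point where the gradient is controlled. -/
lemma twoPoint_tail (hA : Assumptions P F L σ p) (hp₁ : 1 < p) (hp₂ : p ≤ 2) (hL : 0 < L)
    (hσ : 0 < σ) (hμ : 0 < μ) {x : E d}
    (hx : ‖gradient (objective P F) x‖ ≤ 2 * Real.sqrt (L * gapBar L Δ₀ μ)) {t : ℝ}
    (ht : 8 * scale d L σ Δ₀ μ ≤ t) :
    ((unifSphere d).prod P) {z | t < |twoPoint F μ x z.1 z.2|}
      ≤ ENNReal.ofReal ((4 * scale d L σ Δ₀ μ) ^ p * t ^ (-p)) := by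
  have hd : (0 : ℝ) < d := Nat.cast_pos.2 (NeZero.pos d)
  have hsd : 0 < Real.sqrt d := Real.sqrt_pos.2 hd
  set A := Real.sqrt (L * gapBar L Δ₀ μ) with hAdef
  set S := scale d L σ Δ₀ μ with hS
  have hA0 : 0 ≤ A := Real.sqrt_nonneg _
  have hLμ : 0 < L * μ := by positivity
  have hSe : S = A / Real.sqrt d + σ / Real.sqrt d + L * μ := by rw [hS, scale, add_div]
  have hAd : 0 ≤ A / Real.sqrt d := by positivity
  have hσd : 0 < σ / Real.sqrt d := by positivity
  have hS0 : 0 < S := by linarith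
  have ht0 : 0 < t := by linarith
  set g := gradient (objective P F) x with hg
  -- The deterministic gradient is treated as noise of scale 2A, so that its projection gains 1/√d
  -- too. The level t is split as t/2 for the gradient, 3t/8 for the noise and t/8 ≥ Lμ for the
  -- linearisation error.
  have hT1 := tail_inner_sphere (P := P) (N := fun _ => g) hp₁ hp₂ (σ := 2 * A) (by positivity)
    measurable_const (fun s hs => by
      rcases lt_or_ge s ‖g‖ with h | h
      · refine prob_le_one.trans ?_
        rw [ENNReal.one_le_ofReal]
        exact Real.one_le_rpow ((one_le_div hs).2 (h.le.trans hx)) (by linarith)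
      · simp [not_lt.2 h]) (s := t / 2) (by positivity)
  have hT2 := tail_inner_sphere (P := P) hp₁ hp₂ hσ.le (hA.measurable_noise x) (hA.weak_tail x)
    (s := 3 * t / 8) (by positivity)
  have hsub : ∀ᵐ z ∂(unifSphere d).prod P, t < |twoPoint F μ x z.1 z.2| →
      z ∈ {z : Sph d × Ξ | t / 2 < |inner ℝ g (z.1 : E d)|} ∪
        {z : Sph d × Ξ | 3 * t / 8 < |inner ℝ (sampleGrad F x z.2 - g) (z.1 : E d)|} := by
    filter_upwards [ae_abs_twoPoint_sub_inner_le hA hL hμ x] with z hz htz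
    by_contra hcon
    simp only [mem_union, mem_ofPred_eq, not_or, not_lt] at hcon
    have h1 : |twoPoint F μ x z.1 z.2| ≤ |twoPoint F μ x z.1 z.2
        - inner ℝ (sampleGrad F x z.2) (z.1 : E d)| + |inner ℝ g (z.1 : E d)|
        + |inner ℝ (sampleGrad F x z.2 - g) (z.1 : E d)| := by
      refine le_trans (le_of_eq ?_) (abs_add_three _ _ _)
      rw [inner_sub_left]; congr 1; ring
    linarith [hcon.1, hcon.2]
  refine (measure_mono_ae hsub).trans ((measure_union_le _ _).trans ((add_le_add hT1 hT2).trans ?_))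
  rw [← ENNReal.ofReal_add (by positivity) (by positivity)]
  refine ENNReal.ofReal_le_ofReal ?_
  rw [Real.rpow_neg ht0.le, ← div_eq_mul_inv, ← Real.div_rpow (by positivity) ht0.le]
  refine (Real.add_rpow_le_rpow_add (by positivity) (by positivity) hp₁.le).trans ?_
  refine Real.rpow_le_rpow (by positivity) ?_ (by linarith)
  have e1 : 2 * A / Real.sqrt d / (t / 2) = 4 * (A / Real.sqrt d) / t := by field_simp; ring
  have e2 : σ / Real.sqrt d / (3 * t / 8) = (8 / 3) * (σ / Real.sqrt d) / t := by field_simp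
  rw [e1, e2, ← add_div]
  gcongr
  linarith

end TwoPoint

/-! ### Size and error of clipping. -/

section Clip

lemma abs_clip {τ : ℝ} (hτ : 0 < τ) (z : ℝ) : |clip τ z| = min |z| τ := by
  rcases eq_or_ne z 0 with rfl | hz
  · simp [clip, hτ.le]
  have hz' : 0 < |z| := abs_pos.2 hz
  rw [clip, abs_mul, abs_of_nonneg (a := min 1 (τ / |z|)) (by positivity), mul_min_of_nonneg _ _ hz'.le,
    mul_one, mul_div_cancel₀ _ hz'.ne']

lemma abs_sub_clip {τ : ℝ} (hτ : 0 < τ) (z : ℝ) : |z - clip τ z| = max (|z| - τ) 0 := by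
  rcases eq_or_ne z 0 with rfl | hz
  · simp [clip, hτ.le]
  have hz' : 0 < |z| := abs_pos.2 hz
  have h1 : z - clip τ z = z * (1 - min 1 (τ / |z|)) := by rw [clip]; ring
  have h2 : 0 ≤ 1 - min 1 (τ / |z|) := sub_nonneg.2 (min_le_left _ _)
  rw [h1, abs_mul, abs_of_nonneg h2, mul_sub, mul_min_of_nonneg _ _ hz'.le, mul_one,
    mul_div_cancel₀ _ hz'.ne']
  rcases le_total |z| τ with h | h
  · rw [min_eq_left h, max_eq_right (by linarith)]; ring
  · rw [min_eq_right h, max_eq_left (by linarith)]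

lemma measurable_clip (τ : ℝ) : Measurable (clip τ) :=
  measurable_id.mul (measurable_const.min (measurable_const.div measurable_id.abs))

end Clip

/-! ### Accuracy of one clipped batch. -/

section Concentration

variable {Ξ : Type*} [MeasurableSpace Ξ] {d : ℕ} {P : Measure Ξ} {F : E d → Ξ → ℝ}
  {L σ p μ Δ₀ : ℝ}

lemma measurable_twoPoint_right (hA : Assumptions P F L σ p) (μ : ℝ) (x : E d) :
    Measurable fun z : Sph d × Ξ => twoPoint F μ x z.1 z.2 :=
  (hA.measurable_twoPoint μ).comp (measurable_const.prodMk measurable_id)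

lemma integrable_smul_sphere {g : Sph d × Ξ → ℝ} (hg : Integrable g ((unifSphere d).prod P)) :
    Integrable (fun z : Sph d × Ξ => g z • (z.1 : E d)) ((unifSphere d).prod P) := by
  refine hg.mono (hg.aestronglyMeasurable.smul
    (measurable_subtype_coe.comp measurable_fst).aestronglyMeasurable) (Eventually.of_forall ?_)
  intro z
  simp [norm_smul]

variable [NeZero d] [IsProbabilityMeasure P]

/-- The expected excess of the two-point estimate over a high level. -/
lemma lintegral_twoPoint_excess_le (hA : Assumptions P F L σ p) (hp₁ : 1 < p) (hp₂ : p ≤ 2)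
    (hL : 0 < L) (hσ : 0 < σ) (hμ : 0 < μ) {x : E d}
    (hx : ‖gradient (objective P F) x‖ ≤ 2 * Real.sqrt (L * gapBar L Δ₀ μ))
    (hS : 0 < scale d L σ Δ₀ μ) {τ : ℝ} (hτ : 8 * scale d L σ Δ₀ μ ≤ τ) :
    ∫⁻ z, ENNReal.ofReal (|twoPoint F μ x z.1 z.2| - τ) ∂(unifSphere d).prod P
      ≤ ENNReal.ofReal ((4 * scale d L σ Δ₀ μ) ^ p * τ ^ (1 - p) / (p - 1)) :=
  lintegral_sub_le_of_tail (measurable_twoPoint_right hA μ x).abs (by linarith) (by positivity) hp₁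
    fun _ ht => twoPoint_tail hA hp₁ hp₂ hL hσ hμ hx (hτ.trans ht)

lemma integrable_twoPoint (hA : Assumptions P F L σ p) (hp₁ : 1 < p) (hp₂ : p ≤ 2)
    (hL : 0 < L) (hσ : 0 < σ) (hμ : 0 < μ) {x : E d}
    (hx : ‖gradient (objective P F) x‖ ≤ 2 * Real.sqrt (L * gapBar L Δ₀ μ))
    (hS : 0 < scale d L σ Δ₀ μ) :
    Integrable (fun z : Sph d × Ξ => twoPoint F μ x z.1 z.2) ((unifSphere d).prod P) := by
  refine ⟨(measurable_twoPoint_right hA μ x).aestronglyMeasurable, ?_⟩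
  set τ := 8 * scale d L σ Δ₀ μ with hτ
  have hτ0 : 0 < τ := by positivity
  calc ∫⁻ z, ‖twoPoint F μ x z.1 z.2‖ₑ ∂(unifSphere d).prod P
      ≤ ∫⁻ z, (ENNReal.ofReal (|twoPoint F μ x z.1 z.2| - τ) + ENNReal.ofReal τ)
          ∂(unifSphere d).prod P := by
        refine lintegral_mono fun z => ?_
        rw [← ofReal_norm]
        refine le_trans ?_ ENNReal.ofReal_add_le
        simp
    _ = ∫⁻ z, ENNReal.ofReal (|twoPoint F μ x z.1 z.2| - τ) ∂(unifSphere d).prod P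
          + ENNReal.ofReal τ := by
        rw [lintegral_add_right _ measurable_const]; simp
    _ < ⊤ := ENNReal.add_lt_top.2 ⟨(lintegral_twoPoint_excess_le hA hp₁ hp₂ hL hσ hμ hx hS
        le_rfl).trans_lt ENNReal.ofReal_lt_top, ENNReal.ofReal_lt_top⟩

/-- Bias of the unclipped two-point gradient estimator. -/
lemma norm_mean_twoPoint_sub_gradient_le (hA : Assumptions P F L σ p) (hp₁ : 1 < p) (hp₂ : p ≤ 2)
    (hL : 0 < L) (hσ : 0 < σ) (hμ : 0 < μ) {x : E d}
    (hx : ‖gradient (objective P F) x‖ ≤ 2 * Real.sqrt (L * gapBar L Δ₀ μ))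
    (hS : 0 < scale d L σ Δ₀ μ) :
    ‖(d : ℝ) • (∫ z, twoPoint F μ x z.1 z.2 • (z.1 : E d) ∂(unifSphere d).prod P)
      - gradient (objective P F) x‖ ≤ L * μ := by
  have hI := integrable_smul_sphere (integrable_twoPoint hA hp₁ hp₂ hL hσ hμ hx hS)
  rw [integral_prod _ hI]
  have h : ∀ u : Sph d, ∫ ξ, twoPoint F μ x u ξ • (u : E d) ∂P
      = ((objective P F (x + μ • (u : E d)) - objective P F (x - μ • (u : E d))) / (2 * μ))
        • (u : E d) := by
    intro u
    rw [integral_smul_const]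
    simp only [twoPoint, objective]
    rw [integral_div, integral_sub (hA.integrable _) (hA.integrable _)]
  simp_rw [h]
  exact norm_twoPoint_mean_sub_gradient_le hL.le hμ (hA.objective_differentiable hp₁ hσ.le hL)
    (hA.objective_smooth hp₁ hσ.le hL) x

/-- Bias introduced by clipping. -/
lemma norm_mean_clip_sub_le (hA : Assumptions P F L σ p) (hp₁ : 1 < p) (hp₂ : p ≤ 2)
    (hL : 0 < L) (hσ : 0 < σ) (hμ : 0 < μ) {x : E d}
    (hx : ‖gradient (objective P F) x‖ ≤ 2 * Real.sqrt (L * gapBar L Δ₀ μ))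
    (hS : 0 < scale d L σ Δ₀ μ) {τ : ℝ} (hτ : 8 * scale d L σ Δ₀ μ ≤ τ)
    (hI : Integrable (fun z : Sph d × Ξ => clip τ (twoPoint F μ x z.1 z.2))
      ((unifSphere d).prod P)) :
    ‖∫ z, clip τ (twoPoint F μ x z.1 z.2) • (z.1 : E d) ∂(unifSphere d).prod P
      - ∫ z, twoPoint F μ x z.1 z.2 • (z.1 : E d) ∂(unifSphere d).prod P‖
      ≤ (4 * scale d L σ Δ₀ μ) ^ p * τ ^ (1 - p) / (p - 1) := by
  have hτ0 : 0 < τ := by linarith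
  have hp0 : 0 < p - 1 := by linarith
  rw [← integral_sub (integrable_smul_sphere hI)
    (integrable_smul_sphere (integrable_twoPoint hA hp₁ hp₂ hL hσ hμ hx hS))]
  refine (norm_integral_le_lintegral_norm _).trans ?_
  refine ENNReal.toReal_le_of_le_ofReal (by positivity) ?_
  refine le_trans (lintegral_mono fun z => ?_)
    (lintegral_twoPoint_excess_le hA hp₁ hp₂ hL hσ hμ hx hS hτ)
  rw [← sub_smul, norm_smul, Real.norm_eq_abs, abs_sub_comm, abs_sub_clip hτ0]
  simp only [norm_eq_of_mem_sphere, mul_one]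
  rcases le_total (|twoPoint F μ x z.1 z.2| - τ) 0 with h | h
  · rw [max_eq_right h]; simp
  · rw [max_eq_left h]

/-- Concentration of the clipped estimator at a point where the gradient is controlled. -/
lemma estimator_concentration (hA : Assumptions P F L σ p) (hp₁ : 1 < p) (hp₂ : p ≤ 2)
    (hL : 0 < L) (hσ : 0 < σ) (hμ : 0 < μ) {x : E d}
    (hx : ‖gradient (objective P F) x‖ ≤ 2 * Real.sqrt (L * gapBar L Δ₀ μ))
    (hS : 0 < scale d L σ Δ₀ μ) {M : ℕ} {ℓ : ℝ} (hℓ : 1 ≤ ℓ) (hM : ℓ ≤ M) :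
    (Measure.pi fun _ : Fin M => (unifSphere d).prod P)
      {z | constC p * d * scale d L σ Δ₀ μ * (ℓ / M) ^ ((p - 1) / p)
          * Real.sqrt (1 + Real.log (M / ℓ)) + L * μ
        < ‖estimator F μ (8 * scale d L σ Δ₀ μ * (M / ℓ) ^ (1 / p)) x
            (fun i => (z i).1) (fun i => (z i).2) - gradient (objective P F) x‖}
      ≤ ENNReal.ofReal (Real.exp (-ℓ)) := by
  have hd : (0 : ℝ) < d := Nat.cast_pos.2 (NeZero.pos d)
  have hp0 : 0 < p := by linarith
  have hp0' : p ≠ 0 := hp0.ne'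
  have hp1 : 0 < p - 1 := by linarith
  set S := scale d L σ Δ₀ μ with hSdef
  have hℓ0 : 0 < ℓ := by linarith
  have hM0 : (0 : ℝ) < M := by linarith
  set ρ : ℝ := M / ℓ with hρ
  have hρ1 : 1 ≤ ρ := (one_le_div hℓ0).2 hM
  have hρ0 : 0 < ρ := by linarith
  have hlogρ : 0 ≤ Real.log ρ := Real.log_nonneg hρ1
  set Λ := Real.sqrt (1 + Real.log ρ) with hΛ
  have hΛ2 : Λ ^ 2 = 1 + Real.log ρ := Real.sq_sqrt (by linarith)
  have hΛ1 : 1 ≤ Λ := Real.one_le_sqrt.2 (by linarith)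
  set τ := 8 * S * ρ ^ (1 / p) with hτdef
  have hρp : 1 ≤ ρ ^ (1 / p) := Real.one_le_rpow hρ1 (by positivity)
  have hτS : 8 * S ≤ τ := le_mul_of_one_le_right (by positivity) hρp
  have hτ0 : 0 < τ := by positivity
  set Q := (unifSphere d).prod P with hQ
  set Y : Sph d × Ξ → ℝ := fun z => twoPoint F μ x z.1 z.2 with hY
  have hYm : Measurable Y := measurable_twoPoint_right hA μ x
  set Z : Sph d × Ξ → E d := fun z => clip τ (Y z) • (z.1 : E d) with hZ
  have hcm : Measurable fun z => clip τ (Y z) := (measurable_clip τ).comp hYm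
  have hZm : Measurable Z := hcm.smul (measurable_subtype_coe.comp measurable_fst)
  have hZn : ∀ z, ‖Z z‖ = min |Y z| τ := fun z => by
    simp only [hZ]; rw [norm_smul, Real.norm_eq_abs, abs_clip hτ0]; simp
  have hZb : ∀ z, ‖Z z‖ ≤ τ := fun z => (hZn z).trans_le (min_le_right _ _)
  have hZi : Integrable Z Q := Integrable.of_bound hZm.aestronglyMeasurable τ
    (Eventually.of_forall hZb)
  have hci : Integrable (fun z => clip τ (Y z)) Q :=
    Integrable.of_bound hcm.aestronglyMeasurable τ (Eventually.of_forall fun z => by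
      rw [Real.norm_eq_abs, abs_clip hτ0]; exact min_le_right _ _)
  set m := ∫ z, Z z ∂Q with hm
  have hmb : ‖m‖ ≤ τ := by
    simpa using norm_integral_le_of_norm_le_const (μ := Q) (Eventually.of_forall hZb)
  set X : Sph d × Ξ → E d := fun z => Z z - m with hX
  have hXm : Measurable X := hZm.sub_const m
  have hXb : ∀ z, ‖X z‖ ≤ 2 * τ := fun z => (norm_sub_le _ _).trans (by linarith [hZb z])
  have hX0 : ∫ z, X z ∂Q = 0 := by
    simp only [hX]; rw [integral_sub hZi (integrable_const _)]; simp [hm]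
  -- The truncated second moment with a = 8S and b = τ, where log(τ/(8S)) = (log ρ)/p. The term
  -- (8S)² is absorbed because τ ≥ 8S.
  set V := (8 * S) ^ p * τ ^ (2 - p) * Λ ^ 2 with hV
  have hXV : ∫ z, ‖X z‖ ^ 2 ∂Q ≤ V := by
    have h2i : Integrable (fun z => ‖Z z‖ ^ 2) Q :=
      Integrable.of_bound (hZm.norm.pow_const 2).aestronglyMeasurable (τ ^ 2)
        (Eventually.of_forall fun z => by
          rw [norm_pow, norm_norm]; exact pow_le_pow_left₀ (norm_nonneg _) (hZb z) 2)
    have hii : Integrable (fun z => 2 * inner ℝ (Z z) m) Q := (hZi.inner_const m).const_mul 2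
    have e1 : ∫ z, ‖X z‖ ^ 2 ∂Q = ∫ z, ‖Z z‖ ^ 2 ∂Q - ‖m‖ ^ 2 := by
      simp only [hX]
      simp_rw [norm_sub_sq_real]
      rw [integral_add (f := fun z => ‖Z z‖ ^ 2 - 2 * inner ℝ (Z z) m) (h2i.sub hii)
        (integrable_const _), integral_sub h2i hii,
        integral_const_mul]
      simp_rw [real_inner_comm m]
      rw [integral_inner hZi, real_inner_self_eq_norm_sq]
      simp; ring
    have e2 := integral_min_sq_le_of_tail (Q := Q) hYm.abs (fun z => abs_nonneg _)
      (a := 8 * S) (b := τ) (by positivity) hτS (c := (4 * S) ^ p) (by positivity) hp₂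
      fun t ht => twoPoint_tail hA hp₁ hp₂ hL hσ hμ hx ht
    simp_rw [← hZn] at e2
    rw [e1]
    have e3 : Real.log (τ / (8 * S)) = 1 / p * Real.log ρ := by
      rw [hτdef, mul_div_cancel_left₀ _ (by positivity), Real.log_rpow hρ0]
    rw [e3] at e2
    have e4 : (8 * S) ^ 2 ≤ (8 * S) ^ p * τ ^ (2 - p) := by
      calc (8 * S) ^ 2 = (8 * S) ^ p * (8 * S) ^ (2 - p) := by
            rw [← Real.rpow_add (by positivity), ← Real.rpow_two]; congr 1; ring
        _ ≤ _ := by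
            gcongr
    have e5 : 2 * (4 * S) ^ p * τ ^ (2 - p) * (1 / p * Real.log ρ)
        ≤ (8 * S) ^ p * τ ^ (2 - p) * Real.log ρ := by
      have h8 : (8 * S) ^ p = 2 ^ p * (4 * S) ^ p := by
        rw [← Real.mul_rpow (by norm_num) (by positivity)]; congr 1; ring
      have h2p : 2 * (1 / p) ≤ (2 : ℝ) ^ p := by
        have h1 : 1 / p ≤ 1 := (div_le_one hp0).2 hp₁.le
        have h2 : (2 : ℝ) ^ (1 : ℝ) ≤ 2 ^ p := Real.rpow_le_rpow_of_exponent_le (by norm_num) hp₁.le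
        rw [Real.rpow_one] at h2
        linarith
      rw [h8]
      calc 2 * (4 * S) ^ p * τ ^ (2 - p) * (1 / p * Real.log ρ)
          = 2 * (1 / p) * ((4 * S) ^ p * τ ^ (2 - p) * Real.log ρ) := by ring
        _ ≤ 2 ^ p * ((4 * S) ^ p * τ ^ (2 - p) * Real.log ρ) := by gcongr
        _ = _ := by ring
    rw [hV, hΛ2]
    nlinarith [sq_nonneg ‖m‖]
  -- Since ‖X‖ ≤ 2τ and Λ ≥ 1, this satisfies λ‖X‖ ≤ 1. As τ^p = (8S)^p ρ, the variance term Mλ²V is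
  -- ℓ/4. At r = 4τΛℓ the exponent is ℓ/4 - 2ℓ, and the spare 3ℓ/4 absorbs the factor 2 because ℓ ≥
  -- 1 and log 2 < 3/4.
  set lam := 1 / (2 * τ * Λ) with hlam
  have hlam0 : 0 < lam := by positivity
  have hB := pi_norm_sum_gt_le (Q := Q) hXm hlam0 (fun z => by
    rw [hlam, div_mul_eq_mul_div, one_mul, div_le_one (by positivity)]
    nlinarith [hXb z]) hX0 hXV M (4 * τ * Λ * ℓ)
  have hMV : (M : ℝ) * (lam ^ 2 * V) = ℓ / 4 := by
    have h1 : τ ^ p = (8 * S) ^ p * ρ := by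
      rw [hτdef, Real.mul_rpow (by positivity) (by positivity), ← Real.rpow_mul hρ0.le,
        one_div_mul_cancel hp0', Real.rpow_one]
    have h2 : τ ^ (2 - p) = τ ^ 2 / τ ^ p := by
      rw [Real.rpow_sub hτ0, Real.rpow_two]
    rw [hV, h2, h1, hlam, hρ]
    field_simp
    norm_num
  have hlr : lam * (4 * τ * Λ * ℓ) = 2 * ℓ := by rw [hlam]; field_simp; norm_num
  rw [hMV, hlr] at hB
  have hfin : 2 * Real.exp (ℓ / 4 - 2 * ℓ) ≤ Real.exp (-ℓ) := by
    have h2 : (2 : ℝ) = Real.exp (Real.log 2) := (Real.exp_log (by norm_num)).symm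
    conv_lhs => rw [h2, ← Real.exp_add]
    refine Real.exp_le_exp.2 ?_
    rw [← h2]
    have := Real.log_two_lt_d9
    linarith
  refine le_trans (measure_mono fun z hz => ?_) (hB.trans (ENNReal.ofReal_le_ofReal hfin))
  by_contra hcon
  simp only [mem_ofPred_eq, not_lt] at hcon hz
  refine absurd hz (not_lt.2 ?_)
  have hb1 := norm_mean_twoPoint_sub_gradient_le hA hp₁ hp₂ hL hσ hμ hx hS
  have hb2 := norm_mean_clip_sub_le hA hp₁ hp₂ hL hσ hμ hx hS hτS hci
  set w := ∫ z, twoPoint F μ x z.1 z.2 • (z.1 : E d) ∂(unifSphere d).prod P with hw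
  -- Fluctuation, clipping bias and smoothing bias, in this order.
  have hdec : estimator F μ τ x (fun i => (z i).1) (fun i => (z i).2) - gradient (objective P F) x
      = ((d : ℝ) / M) • ∑ i, X (z i) + (d : ℝ) • (m - w)
        + ((d : ℝ) • w - gradient (objective P F) x) := by
    have hs : ∑ i, X (z i) = ∑ i, Z (z i) - (M : ℝ) • m := by
      simp only [hX]
      rw [Finset.sum_sub_distrib]
      simp [Nat.cast_smul_eq_nsmul]
    have he : estimator F μ τ x (fun i => (z i).1) (fun i => (z i).2)
        = ((d : ℝ) / M) • ∑ i, Z (z i) := rfl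
    rw [he, hs, smul_sub, smul_smul, div_mul_cancel₀ _ hM0.ne']
    module
  have hρe : (ℓ / M) ^ ((p - 1) / p) = ρ ^ (1 / p) / ρ := by
    rw [show ℓ / M = ρ⁻¹ by rw [hρ, inv_div], Real.inv_rpow hρ0.le, ← Real.rpow_neg hρ0.le,
      ← Real.rpow_sub_one hρ0.ne']
    congr 1; field_simp; ring
  have hτρ : τ ^ (1 - p) = (8 * S) ^ (1 - p) * (ρ ^ (1 / p) / ρ) := by
    rw [hτdef, Real.mul_rpow (by positivity) (by positivity), ← Real.rpow_mul hρ0.le,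
      ← Real.rpow_sub_one hρ0.ne']
    congr 2; field_simp
  have h48 : (4 * S) ^ p * (8 * S) ^ (1 - p) = 2 ^ (3 - p) * S := by
    rw [Real.mul_rpow (by norm_num) hS.le, Real.mul_rpow (by norm_num) hS.le,
      show (4 : ℝ) = 2 ^ (2 : ℝ) by norm_num, show (8 : ℝ) = 2 ^ (3 : ℝ) by norm_num,
      ← Real.rpow_mul (by norm_num), ← Real.rpow_mul (by norm_num)]
    calc _ = (2 : ℝ) ^ (2 * p) * 2 ^ (3 * (1 - p)) * (S ^ p * S ^ (1 - p)) := by ring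
      _ = _ := by
        rw [← Real.rpow_add (by norm_num), ← Real.rpow_add hS]
        rw [show p + (1 - p) = 1 by ring, Real.rpow_one]
        congr 2; ring
  rw [hdec]
  refine (norm_add₃_le).trans ?_
  rw [norm_smul, norm_smul, Real.norm_of_nonneg (by positivity), Real.norm_of_nonneg hd.le]
  set κ := ρ ^ (1 / p) / ρ with hκ
  have hκ0 : 0 < κ := by positivity
  have t1 : (d : ℝ) / M * ‖∑ i, X (z i)‖ ≤ 32 * d * S * κ * Λ := by
    calc (d : ℝ) / M * ‖∑ i, X (z i)‖ ≤ (d : ℝ) / M * (4 * τ * Λ * ℓ) := by gcongr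
      _ = 32 * d * S * κ * Λ := by rw [hτdef, hκ, hρ]; field_simp; norm_num
  have t2 : (d : ℝ) * ‖m - w‖ ≤ 2 ^ (4 - p) / (p - 1) * d * S * κ * Λ := by
    have h34 : (2 : ℝ) ^ (3 - p) ≤ 2 ^ (4 - p) :=
      Real.rpow_le_rpow_of_exponent_le (by norm_num) (by linarith)
    calc (d : ℝ) * ‖m - w‖ ≤ d * ((4 * S) ^ p * τ ^ (1 - p) / (p - 1)) := by gcongr
      _ = 2 ^ (3 - p) / (p - 1) * d * S * κ * 1 := by
        rw [hτρ, ← mul_assoc, h48]; ring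
      _ ≤ 2 ^ (4 - p) / (p - 1) * d * S * κ * Λ := by gcongr
  rw [hρe, constC]
  -- The fluctuation uses only 32 of the 120 in `constC`; the rest is slack.
  have : 0 ≤ 88 * d * S * κ * Λ := by positivity
  linarith

end Concentration

/-! ### Descent with inexact gradients. -/

section Descent

variable {H : Type*} [NormedAddCommGroup H] [InnerProductSpace ℝ H] [CompleteSpace H]
  {φ : H → ℝ} {L : ℝ}

/-- One step of inexact gradient descent with stepsize `1 / (4 L)`. -/
lemma inexact_gradient_step (hL : 0 < L) (hφ : Differentiable ℝ φ)
    (hlip : ∀ x y, ‖gradient φ x - gradient φ y‖ ≤ L * ‖x - y‖) (x g : H) :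
    φ (x - (1 / (4 * L)) • g) + 1 / (8 * L) * ‖gradient φ x‖ ^ 2
      ≤ φ x + 1 / (8 * L) * ‖g - gradient φ x‖ ^ 2 := by
  have h := le_add_inner_gradient_add hφ hlip x (-((1 / (4 * L)) • g))
  rw [← sub_eq_add_neg, norm_neg, norm_smul, mul_pow, Real.norm_eq_abs, sq_abs, inner_neg_right,
    inner_smul_right] at h
  set G := gradient φ x
  have hg : ‖g‖ ^ 2 = ‖G‖ ^ 2 + 2 * inner ℝ G (g - G) + ‖g - G‖ ^ 2 := by
    rw [← norm_add_sq_real, add_sub_cancel]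
  have hi : inner ℝ G g = ‖G‖ ^ 2 + inner ℝ G (g - G) := by
    rw [inner_sub_right, real_inner_self_eq_norm_sq]; ring
  have hc : -(‖G‖ * ‖g - G‖) ≤ inner ℝ G (g - G) := (abs_le.1 (abs_real_inner_le_norm G (g - G))).1
  rw [hg, hi] at h
  set i := inner ℝ G (g - G)
  have e : φ x + -(1 / (4 * L) * (‖G‖ ^ 2 + i))
      + L / 2 * ((1 / (4 * L)) ^ 2 * (‖G‖ ^ 2 + 2 * i + ‖g - G‖ ^ 2))
      = φ x + 1 / (8 * L) * ‖g - G‖ ^ 2 - 1 / (8 * L) * ‖G‖ ^ 2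
        - 1 / (32 * L) * (3 * ‖G‖ ^ 2 + 6 * i + 3 * ‖g - G‖ ^ 2) := by field_simp; ring
  rw [e] at h
  -- The bracket is 3‖g‖², the part of the descent that the statement gives away.
  have : 0 ≤ 1 / (32 * L) * (3 * ‖G‖ ^ 2 + 6 * i + 3 * ‖g - G‖ ^ 2) := by
    refine mul_nonneg (by positivity) ?_
    nlinarith [sq_nonneg (‖G‖ - ‖g - G‖)]
  linarith

/-- Inexact gradient descent, when the gradient error is controlled only where the gradient is
bounded by its size on the initial sublevel set, up to a constant. -/
lemma inexact_gradient_descent (hL : 0 < L) (hφ : Differentiable ℝ φ)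
    (hlip : ∀ x y, ‖gradient φ x - gradient φ y‖ ≤ L * ‖x - y‖) {m D ε : ℝ}
    (hm : ∀ x, m ≤ φ x) {T : ℕ} (hT0 : 0 < T) (hT : 32 * L * D ≤ T * ε ^ 2)
    (hT' : T * ε ^ 2 ≤ 96 * L * D) {x g : ℕ → H} (hx0 : φ (x 0) - m ≤ D)
    (hx : ∀ t, x (t + 1) = x t - (1 / (4 * L)) • g t)
    (hg : ∀ t < T, ‖gradient φ (x t)‖ ≤ 2 * Real.sqrt (L * D) →
      ‖g t - gradient φ (x t)‖ ≤ ε / 4) :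
    (1 / (T : ℝ)) * ∑ t ∈ Finset.range T, ‖gradient φ (x t)‖ ^ 2 ≤ ε ^ 2 := by
  have hD : 0 ≤ L * D := by
    have : 0 ≤ (T : ℝ) * ε ^ 2 := by positivity
    linarith
  -- Each step loses at most (ε/4)²/(8L) = ε²/(128L). By Tε² ≤ 96LD the total loss is at most 3D/4,
  -- so the gap stays below 7D/4 and ‖∇φ‖² ≤ 7LD/2 < 4LD unless LD = 0, when both sides vanish. The
  -- accuracy hypothesis is thus available at the next step.
  have key : ∀ t ≤ T, φ (x t) - m + 1 / (8 * L) * ∑ s ∈ Finset.range t, ‖gradient φ (x s)‖ ^ 2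
      ≤ D + t * (ε ^ 2 / (128 * L)) := by
    intro t
    induction t with
    | zero => intro _; simpa using hx0
    | succ t ih =>
      intro ht
      have h1 := ih (by omega)
      have htT : (t : ℝ) ≤ T := by exact_mod_cast (by omega : t ≤ T)
      have hgap : φ (x t) - m ≤ 7 / 4 * D := by
        have h2 : 0 ≤ 1 / (8 * L) * ∑ s ∈ Finset.range t, ‖gradient φ (x s)‖ ^ 2 := by positivity
        have h3 : (t : ℝ) * (ε ^ 2 / (128 * L)) ≤ 3 / 4 * D := by
          rw [← mul_div_assoc, div_le_iff₀ (by positivity)]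
          calc (t : ℝ) * ε ^ 2 ≤ T * ε ^ 2 := by gcongr
            _ ≤ 96 * L * D := hT'
            _ = _ := by ring
        linarith
      have hgrad : ‖gradient φ (x t)‖ ≤ 2 * Real.sqrt (L * D) := by
        have h4 := norm_gradient_sq_le hL hφ hlip hm (x t)
        refine le_of_sq_le_sq ?_ (by positivity)
        rw [mul_pow, Real.sq_sqrt hD]
        nlinarith
      have herr := hg t (by omega) hgrad
      have herr2 : ‖g t - gradient φ (x t)‖ ^ 2 ≤ (ε / 4) ^ 2 :=
        pow_le_pow_left₀ (norm_nonneg _) herr 2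
      have hstep := inexact_gradient_step hL hφ hlip (x t) (g t)
      rw [← hx t] at hstep
      have h5 : 1 / (8 * L) * ‖g t - gradient φ (x t)‖ ^ 2 ≤ ε ^ 2 / (128 * L) := by
        calc _ ≤ 1 / (8 * L) * (ε / 4) ^ 2 := by gcongr
              _ = _ := by field_simp; ring
      rw [Finset.sum_range_succ, mul_add]
      push_cast
      linarith
  have hfin := key T le_rfl
  have h1 := hm (x T)
  have hT0' : (0 : ℝ) < T := Nat.cast_pos.2 hT0
  set G := ∑ t ∈ Finset.range T, ‖gradient φ (x t)‖ ^ 2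
  rw [one_div_mul_eq_div, div_le_iff₀ hT0']
  have h2 : 1 / (8 * L) * G ≤ D + T * (ε ^ 2 / (128 * L)) := by linarith
  have h3 : G ≤ 8 * (L * D) + T * ε ^ 2 / 16 := by
    have := mul_le_mul_of_nonneg_left h2 (by positivity : 0 ≤ 8 * L)
    have e1 : 8 * L * (1 / (8 * L) * G) = G := by field_simp
    have e2 : 8 * L * (D + T * (ε ^ 2 / (128 * L))) = 8 * (L * D) + T * ε ^ 2 / 16 := by
      field_simp; ring
    linarith
  nlinarith

end Descent

/-! ### Independence of each iterate from the next batch. -/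

section Stream

variable {Ξ : Type*} [MeasurableSpace Ξ] {d M : ℕ} {P : Measure Ξ} {F : E d → Ξ → ℝ}
  {L σ p : ℝ} {Ω : Type*} {u : ℕ → Fin M → Ω → Sph d} {ξ : ℕ → Fin M → Ω → Ξ}

lemma Assumptions.measurable_estimator (hA : Assumptions P F L σ p) (μ τ : ℝ) :
    Measurable fun z : E d × (Fin M → Sph d × Ξ) =>
      estimator F μ τ z.1 (fun i => (z.2 i).1) (fun i => (z.2 i).2) := by
  have h : ∀ i : Fin M, Measurable fun z : E d × (Fin M → Sph d × Ξ) => z.2 i :=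
    fun i => (measurable_pi_apply i).comp measurable_snd
  have hc : ∀ i : Fin M, Measurable fun z : E d × (Fin M → Sph d × Ξ) =>
      clip τ (twoPoint F μ z.1 (z.2 i).1 (z.2 i).2) := fun i =>
    (measurable_clip τ).comp ((hA.measurable_twoPoint μ).comp (measurable_fst.prodMk (h i)))
  have hu : ∀ i : Fin M, Measurable fun z : E d × (Fin M → Sph d × Ξ) => ((z.2 i).1 : E d) :=
    fun i => measurable_subtype_coe.comp (measurable_fst.comp (h i))
  exact (Finset.measurable_sum Finset.univ fun i _ => (hc i).smul (hu i)).const_smul ((d : ℝ) / M)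

/-- The pair of samples with a given index. -/
def samplePair (u : ℕ → Fin M → Ω → Sph d) (ξ : ℕ → Fin M → Ω → Ξ) (i : ℕ × Fin M) (ω : Ω) :
    Sph d × Ξ := (u i.1 i.2 ω, ξ i.1 i.2 ω)

/-- The iterates are measurable functions of the earlier samples. -/
lemma exists_iterates_eq (hA : Assumptions P F L σ p) (μ τ α : ℝ) (x₀ : E d) (t : ℕ) :
    ∃ φ : ((Finset.range t ×ˢ (Finset.univ : Finset (Fin M)) : Finset (ℕ × Fin M)) → Sph d × Ξ)
        → E d, Measurable φ ∧ ∀ (u : ℕ → Fin M → Ω → Sph d) (ξ : ℕ → Fin M → Ω → Ξ) (ω : Ω),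
      iterates F μ τ α x₀ (fun s ℓ => u s ℓ ω) (fun s ℓ => ξ s ℓ ω) t
        = φ fun i => samplePair u ξ i ω := by
  induction t with
  | zero => exact ⟨fun _ => x₀, measurable_const, fun _ _ _ => rfl⟩
  | succ t ih =>
    obtain ⟨φ, hφm, hφ⟩ := ih
    have hsub : ∀ i ∈ Finset.range t ×ˢ (Finset.univ : Finset (Fin M)),
        i ∈ Finset.range (t + 1) ×ˢ (Finset.univ : Finset (Fin M)) := by
      intro i hi
      simp only [Finset.mem_product, Finset.mem_range, Finset.mem_univ, and_true] at hi ⊢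
      omega
    have hmem : ∀ ℓ : Fin M, (t, ℓ) ∈ Finset.range (t + 1) ×ˢ (Finset.univ : Finset (Fin M)) := by
      intro ℓ; simp
    refine ⟨fun w => φ (fun i => w ⟨i, hsub i i.2⟩) - α • estimator F μ τ
      (φ (fun i => w ⟨i, hsub i i.2⟩)) (fun ℓ => (w ⟨(t, ℓ), hmem ℓ⟩).1)
        (fun ℓ => (w ⟨(t, ℓ), hmem ℓ⟩).2), ?_, ?_⟩
    · have h1 : Measurable fun w : (Finset.range (t + 1) ×ˢ (Finset.univ : Finset (Fin M)) :
          Finset (ℕ × Fin M)) → Sph d × Ξ => φ (fun i => w ⟨i, hsub i i.2⟩) :=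
        hφm.comp (measurable_pi_lambda _ fun i => measurable_pi_apply _)
      have h2 : Measurable fun w : (Finset.range (t + 1) ×ˢ (Finset.univ : Finset (Fin M)) :
          Finset (ℕ × Fin M)) → Sph d × Ξ => fun ℓ : Fin M => w ⟨(t, ℓ), hmem ℓ⟩ :=
        measurable_pi_lambda _ fun ℓ => measurable_pi_apply _
      exact h1.sub (((hA.measurable_estimator μ τ).comp (h1.prodMk h2)).const_smul α)
    · intro u ξ ω
      rw [iterates, hφ u ξ ω]
      rfl

variable [MeasurableSpace Ω] {ν : Measure Ω}

lemma IsSampleStream.measurable_samplePair (hs : IsSampleStream ν P u ξ) (i : ℕ × Fin M) :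
    Measurable (samplePair u ξ i) :=
  (hs.measurable_u i.1 i.2).prodMk (hs.measurable_ξ i.1 i.2)

variable [IsProbabilityMeasure ν]

lemma IsSampleStream.map_batch (hs : IsSampleStream ν P u ξ) (t : ℕ) :
    ν.map (fun ω ℓ => samplePair u ξ (t, ℓ) ω) = Measure.pi fun _ => (unifSphere d).prod P := by
  have h : iIndepFun (fun ℓ : Fin M => samplePair u ξ (t, ℓ)) ν :=
    hs.indep.precomp (g := fun ℓ : Fin M => (t, ℓ)) (fun a b hab => by simpa using hab)
  rw [iIndepFun_iff_map_fun_eq_pi_map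
    (fun ℓ => (hs.measurable_samplePair (t, ℓ)).aemeasurable)] at h
  refine h.trans ?_
  congr 1
  funext ℓ
  exact hs.law t ℓ

/-- An event about an iterate and the next batch is as rare as its sections. -/
lemma IsSampleStream.measure_iterate_batch_le [NeZero d] [IsProbabilityMeasure P]
    (hs : IsSampleStream ν P u ξ) (hA : Assumptions P F L σ p) (μ τ α : ℝ) (x₀ : E d)
    (t : ℕ) {B : Set (E d × (Fin M → Sph d × Ξ))} (hB : MeasurableSet B) {c : ENNReal}
    (hc : ∀ x, (Measure.pi fun _ => (unifSphere d).prod P) (Prod.mk x ⁻¹' B) ≤ c) :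
    ν {ω | (iterates F μ τ α x₀ (fun s ℓ => u s ℓ ω) (fun s ℓ => ξ s ℓ ω) t,
      fun ℓ => samplePair u ξ (t, ℓ) ω) ∈ B} ≤ c := by
  obtain ⟨φ, hφm, hφ⟩ := exists_iterates_eq (Ω := Ω) (M := M) hA μ τ α x₀ t
  set X : Ω → E d := fun ω => iterates F μ τ α x₀ (fun s ℓ => u s ℓ ω) (fun s ℓ => ξ s ℓ ω) t
    with hX
  set Y : Ω → Fin M → Sph d × Ξ := fun ω ℓ => samplePair u ξ (t, ℓ) ω with hY
  have hYm : Measurable Y := measurable_pi_lambda _ fun ℓ => hs.measurable_samplePair _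
  have hXe : X = fun ω => φ fun i => samplePair u ξ i ω := funext fun ω => hφ u ξ ω
  have hXm : Measurable X := by
    rw [hXe]
    exact hφm.comp (measurable_pi_lambda _ fun i => hs.measurable_samplePair _)
  have hdisj : Disjoint (Finset.range t ×ˢ (Finset.univ : Finset (Fin M)))
      ({t} ×ˢ (Finset.univ : Finset (Fin M))) := by
    rw [Finset.disjoint_left]
    rintro ⟨a, b⟩ h1 h2
    simp only [Finset.mem_product, Finset.mem_range, Finset.mem_univ, and_true,
      Finset.mem_singleton] at h1 h2
    omega
  have hmem : ∀ ℓ : Fin M, (t, ℓ) ∈ ({t} ×ˢ (Finset.univ : Finset (Fin M)) : Finset (ℕ × Fin M)) :=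
    fun ℓ => by simp
  have hind : IndepFun X Y ν := by
    -- The iterate uses only samples with time index below t and the batch only those at t, so their
    -- joint law is a product and the event can be integrated by sections.
    have h := hs.indep.indepFun_finset _ _ hdisj hs.measurable_samplePair
    have h2 := h.comp (φ := φ) (ψ := fun w ℓ => w ⟨(t, ℓ), hmem ℓ⟩) hφm
      (measurable_pi_lambda _ fun ℓ => measurable_pi_apply _)
    rw [hXe]
    exact h2
  have hlaw := (indepFun_iff_map_prod_eq_prod_map_map hXm.aemeasurable hYm.aemeasurable).1 hind
  rw [hs.map_batch t] at hlaw
  have : {ω | (X ω, Y ω) ∈ B} = (fun ω => (X ω, Y ω)) ⁻¹' B := rfl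
  rw [this, ← Measure.map_apply (hXm.prodMk hYm) hB, hlaw, Measure.prod_apply hB]
  have hp : IsProbabilityMeasure (ν.map X) := Measure.isProbabilityMeasure_map hXm.aemeasurable
  calc _ ≤ ∫⁻ _, c ∂ν.map X := lintegral_mono hc
    _ = c := by simp

end Stream

/-! ### Arithmetic of the horizon. -/

section Horizon

variable {L Δ₀ μ ε : ℝ}

lemma three_le_horizon : 3 ≤ horizon L Δ₀ μ ε := le_max_left _ _

lemma le_horizon_mul (hε : 0 < ε) : 32 * L * gapBar L Δ₀ μ ≤ horizon L Δ₀ μ ε * ε ^ 2 := by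
  rw [← div_le_iff₀ (by positivity)]
  refine (Nat.le_ceil _).trans ?_
  exact_mod_cast le_max_right _ _

lemma horizon_mul_le (hε : 0 < ε) (h : ε ^ 2 ≤ 32 * L * gapBar L Δ₀ μ) :
    horizon L Δ₀ μ ε * ε ^ 2 ≤ 96 * L * gapBar L Δ₀ μ := by
  set a := 32 * L * gapBar L Δ₀ μ / ε ^ 2 with ha
  have ha1 : 1 ≤ a := (one_le_div (by positivity)).2 h
  -- Since a ≥ 1, both entries of the maximum are at most 3a: 3 trivially, and the ceiling because a
  -- + 1 ≤ 2a.
  have h1 : (horizon L Δ₀ μ ε : ℝ) ≤ 3 * a := by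
    rw [horizon, Nat.cast_max]
    refine max_le (by push_cast; linarith) ?_
    have := (Nat.ceil_lt_add_one (by linarith : 0 ≤ a)).le
    linarith
  calc horizon L Δ₀ μ ε * ε ^ 2 ≤ 3 * a * ε ^ 2 := by gcongr
    _ = 96 * L * gapBar L Δ₀ μ := by rw [ha]; field_simp; ring

lemma one_le_log_of_three_le {y : ℝ} (hy : 3 ≤ y) : 1 ≤ Real.log y := by
  rw [Real.le_log_iff_exp_le (by linarith)]
  have := Real.exp_one_lt_d9
  linarith

lemma one_le_log_horizon_div {δ : ℝ} (hδ : 0 < δ) (hδ₁ : δ ≤ 1) :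
    1 ≤ Real.log (horizon L Δ₀ μ ε / δ) := by
  refine one_le_log_of_three_le ?_
  have h3 : (3 : ℝ) ≤ horizon L Δ₀ μ ε := by exact_mod_cast three_le_horizon
  rw [le_div_iff₀ hδ]
  nlinarith

end Horizon

/-! ### Number of queries. -/

section QueryLog

variable {Ξ : Type*} {d : ℕ}

lemma length_queryLog (F : E d → Ξ → ℝ) (μ τ α : ℝ) {M : ℕ} (x₀ : E d)
    (u : ℕ → Fin M → Sph d) (ξ : ℕ → Fin M → Ξ) (T : ℕ) :
    (queryLog F μ τ α x₀ u ξ T).length = 2 * M * T := by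
  simp [queryLog, List.length_flatMap]
  ring

end QueryLog

/-! ### Union bound and convergence with high probability. -/

section HighProbability

variable {Ξ : Type*} [MeasurableSpace Ξ] {d M : ℕ} {P : Measure Ξ} {F : E d → Ξ → ℝ}
  {L σ p Δ₀ ε δ μ : ℝ} {Ω : Type*} [MeasurableSpace Ω] {ν : Measure Ω}
  {u : ℕ → Fin M → Ω → Sph d} {ξ : ℕ → Fin M → Ω → Ξ}

/-- The pairs of a point with controlled gradient and a batch whose estimate there is inaccurate. -/
def badEvent (P : Measure Ξ) (F : E d → Ξ → ℝ) (L Δ₀ μ τ ε : ℝ) (M : ℕ) :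
    Set (E d × (Fin M → Sph d × Ξ)) :=
  {z | ‖gradient (objective P F) z.1‖ ≤ 2 * Real.sqrt (L * gapBar L Δ₀ μ) ∧
    ε / 4 < ‖estimator F μ τ z.1 (fun i => (z.2 i).1) (fun i => (z.2 i).2)
      - gradient (objective P F) z.1‖}

variable [IsProbabilityMeasure P] [IsProbabilityMeasure ν]

lemma measurableSet_badEvent (hA : Assumptions P F L σ p) (hp₁ : 1 < p) (hL : 0 < L)
    (hσ : 0 < σ) (τ : ℝ) : MeasurableSet (badEvent P F L Δ₀ μ τ ε M) := by
  have hg : Measurable (gradient (objective P F)) := by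
    have : LipschitzWith (Real.toNNReal L) (gradient (objective P F)) :=
      LipschitzWith.of_dist_le_mul fun x y => by
        rw [dist_eq_norm, dist_eq_norm, Real.coe_toNNReal _ hL.le]
        exact hA.objective_smooth hp₁ hσ.le hL x y
    exact this.continuous.measurable
  have hg1 : Measurable fun z : E d × (Fin M → Sph d × Ξ) => gradient (objective P F) z.1 :=
    hg.comp measurable_fst
  exact (measurableSet_le hg1.norm measurable_const).inter
    (measurableSet_lt measurable_const ((hA.measurable_estimator μ τ).sub hg1).norm)

/-- Convergence of RSC-ZO with high probability. -/
lemma exists_event_convergence [NeZero d] (hp₁ : 1 < p) (hp₂ : p ≤ 2) (hL : 0 < L)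
    (hσ : 0 < σ) (hε : 0 < ε) (hδ : 0 < δ) (hδ₁ : δ ≤ 1)
    (had : Admissible d p L σ Δ₀ ε δ μ M) {x₀ : E d} (hA : Assumptions P F L σ p)
    (h0 : initialGap P F x₀ = Δ₀) (hs : IsSampleStream ν P u ξ) {T : ℕ} {τ : ℝ}
    (hT : T = horizon L Δ₀ μ ε) (hτ : τ = threshold d p L σ Δ₀ μ δ M T) {x : ℕ → Ω → E d}
    (hx : ∀ t ω, x t ω
      = iterates F μ τ (1 / (4 * L)) x₀ (fun s ℓ => u s ℓ ω) (fun s ℓ => ξ s ℓ ω) t) :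
    ∃ A : Set Ω, MeasurableSet A ∧ ENNReal.ofReal (1 - δ) ≤ ν A ∧ ∀ ω ∈ A,
      (1 / (T : ℝ)) * ∑ t ∈ Finset.range T,
        ‖gradient (objective P F) (x t ω)‖ ^ 2 ≤ ε ^ 2 := by
  have hμ := had.mu_pos
  have hd : (0 : ℝ) < d := Nat.cast_pos.2 (NeZero.pos d)
  set ℓ := Real.log (T / δ) with hℓ
  have hT3 : 3 ≤ T := hT ▸ three_le_horizon
  have hT0 : (0 : ℝ) < T := Nat.cast_pos.2 (by omega)
  have hℓ1 : 1 ≤ ℓ := by rw [hℓ, hT]; exact one_le_log_horizon_div hδ hδ₁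
  have hM : ℓ ≤ M := by rw [hℓ, hT]; exact had.log_le
  have hS : 0 < scale d L σ Δ₀ μ := by rw [scale]; positivity
  have hexp : Real.exp (-ℓ) = δ / T := by
    rw [Real.exp_neg, hℓ, Real.exp_log (by positivity), inv_div]
  have hη := had.eta_le
  rw [← hT, eta, ← hℓ] at hη
  set B := badEvent P F L Δ₀ μ τ ε M with hB
  have hBm : MeasurableSet B := measurableSet_badEvent hA hp₁ hL hσ τ
  -- The gradient condition is part of `badEvent`, so sections over points with large gradient are
  -- empty and the bound is uniform in y. No stopping time is needed.
  have hsec : ∀ y : E d, (Measure.pi fun _ : Fin M => (unifSphere d).prod P) (Prod.mk y ⁻¹' B)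
      ≤ ENNReal.ofReal (δ / T) := by
    intro y
    by_cases hy : ‖gradient (objective P F) y‖ ≤ 2 * Real.sqrt (L * gapBar L Δ₀ μ)
    · rw [← hexp]
      refine le_trans (measure_mono fun z hz => ?_)
        (estimator_concentration hA hp₁ hp₂ hL hσ hμ hy hS hℓ1 hM)
      have h2 : ε / 4 < _ := hz.2
      rw [hτ, threshold, ← hℓ] at h2
      exact hη.trans_lt h2
    · have : Prod.mk y ⁻¹' B = ∅ := by
        ext z
        simp only [mem_preimage, mem_empty_iff_false, iff_false]
        exact fun hz => hy hz.1
      rw [this]; simp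
  set Bad : ℕ → Set Ω := fun t => {ω | (x t ω, fun i => samplePair u ξ (t, i) ω) ∈ B} with hBad
  have hxe : ∀ t, x t = fun ω =>
      iterates F μ τ (1 / (4 * L)) x₀ (fun s ℓ => u s ℓ ω) (fun s ℓ => ξ s ℓ ω) t :=
    fun t => funext fun ω => hx t ω
  have hBadle : ∀ t, ν (Bad t) ≤ ENNReal.ofReal (δ / T) := fun t => by
    simp only [hBad, hxe]
    exact hs.measure_iterate_batch_le hA μ τ _ x₀ t hBm hsec
  have hBadm : ∀ t, MeasurableSet (Bad t) := fun t => by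
    obtain ⟨φ, hφm, hφ⟩ := exists_iterates_eq (Ω := Ω) (M := M) hA μ τ (1 / (4 * L)) x₀ t
    have hxm : Measurable (x t) := by
      rw [hxe, funext (hφ u ξ)]
      exact hφm.comp (measurable_pi_lambda _ fun i => hs.measurable_samplePair _)
    exact (hxm.prodMk (measurable_pi_lambda _ fun i => hs.measurable_samplePair _)) hBm
  refine ⟨(⋃ t ∈ Finset.range T, Bad t)ᶜ,
    (Finset.measurableSet_biUnion _ fun t _ => hBadm t).compl, ?_, ?_⟩
  · rw [prob_compl_eq_one_sub (Finset.measurableSet_biUnion _ fun t _ => hBadm t),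
      ENNReal.ofReal_sub _ hδ.le, ENNReal.ofReal_one]
    refine tsub_le_tsub_left ?_ _
    calc ν (⋃ t ∈ Finset.range T, Bad t) ≤ ∑ t ∈ Finset.range T, ν (Bad t) :=
          measure_biUnion_finset_le _ _
      _ ≤ ∑ t ∈ Finset.range T, ENNReal.ofReal (δ / T) := Finset.sum_le_sum fun t _ => hBadle t
      _ = ENNReal.ofReal δ := by
          rw [Finset.sum_const, Finset.card_range, nsmul_eq_mul, ← ENNReal.ofReal_natCast,
            ← ENNReal.ofReal_mul hT0.le, mul_div_cancel₀ _ hT0.ne']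
  · intro ω hω
    simp only [mem_compl_iff, mem_iUnion, Finset.mem_range, not_exists] at hω
    refine inexact_gradient_descent hL (hA.objective_differentiable hp₁ hσ.le hL)
      (hA.objective_smooth hp₁ hσ.le hL) (m := ⨅ y, objective P F y)
      (fun y => ciInf_le hA.bddBelow y) (D := gapBar L Δ₀ μ) (by omega)
      (hT ▸ le_horizon_mul hε) (hT ▸ horizon_mul_le hε had.eps_le) (x := fun t => x t ω)
      (g := fun t => estimator F μ τ (x t ω) (fun i => u t i ω) (fun i => ξ t i ω)) ?_ ?_ ?_
    · have : x 0 ω = x₀ := hx 0 ω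
      simp only [this]
      have h1 : objective P F x₀ - ⨅ y, objective P F y = Δ₀ := h0
      rw [h1, gapBar]
      have : 0 ≤ L * μ ^ 2 / 2 := by positivity
      linarith
    · intro t
      simp only [hx]
      rfl
    · intro t ht hgr
      by_contra hcon
      exact hω t ht ⟨hgr, not_le.1 hcon⟩

end HighProbability

/-! ### From the average to the best iterate. -/

section Average

/-- If the mean of the squared norms is at most `ε ^ 2`, some norm is at most `ε`. -/
lemma exists_norm_le_of_average_sq_le {H : Type*} [NormedAddCommGroup H] {v : ℕ → H} {ε : ℝ}
    (hε : 0 ≤ ε) {T : ℕ} (hT : 0 < T)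
    (h : (1 / (T : ℝ)) * ∑ t ∈ Finset.range T, ‖v t‖ ^ 2 ≤ ε ^ 2) : ∃ t < T, ‖v t‖ ≤ ε := by
  by_contra! hcon
  have hT0 : (0 : ℝ) < T := Nat.cast_pos.2 hT
  rw [one_div_mul_eq_div, div_le_iff₀ hT0] at h
  have h1 : ∑ _t ∈ Finset.range T, ε ^ 2 < ∑ t ∈ Finset.range T, ‖v t‖ ^ 2 :=
    Finset.sum_lt_sum_of_nonempty (Finset.nonempty_range_iff.2 hT.ne') fun t ht =>
      pow_lt_pow_left₀ (hcon t (Finset.mem_range.1 ht)) hε two_ne_zero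
  rw [Finset.sum_const, Finset.card_range, nsmul_eq_mul] at h1
  linarith

end Average

/-! ### Choice of μ and M, and the query count. -/

section Complexity

lemma constC_ge {p : ℝ} (hp₁ : 1 < p) : 120 ≤ constC p := by
  have : 0 < p - 1 := by linarith
  have : 0 ≤ (2 : ℝ) ^ (4 - p) / (p - 1) := by positivity
  rw [constC]; linarith

/-- The factor in front of the logarithm in the choice of the batch size. -/
def batchFactor (p : ℝ) : ℝ := 4 * (p / (p - 1)) + 6 + 64 * (p / (p - 1)) * constC p

/-- The batch size must dominate its own logarithm, so K appears on both sides. The left side is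
affine in K and in w, the right side quadratic in both, and w ≥ 1/2 absorbs the constants. -/
lemma batchFactor_log_bound {b c K w : ℝ} (hb : 0 ≤ b) (hc : 0 ≤ c) (hw : 1 / 2 ≤ w)
    (hK : K = 4 * b + 6 + 64 * b * c) :
    2 + b * (16 * c + w + K * w) ≤ (K * w) ^ 2 := by
  have hbc : 0 ≤ b * c := mul_nonneg hb hc
  have hK1 : 1 ≤ K := by linarith
  have h1 : 2 * (4 + 32 * (b * c) + b + b * K) ≤ K ^ 2 := by nlinarith
  have h2 : 2 + b * (16 * c + w + K * w) ≤ w * (4 + 32 * (b * c) + b + b * K) := by nlinarith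
  have h3 : w * (4 + 32 * (b * c) + b + b * K) ≤ w * (K ^ 2 / 2) := by gcongr; linarith
  have h4 : w * (K ^ 2 / 2) ≤ (K * w) ^ 2 := by
    have : 0 ≤ K ^ 2 * w := by positivity
    nlinarith
  linarith

/-- A batch size for which the stochastic error of the estimator is below a given level. -/
lemma exists_batch_size {b c K w r ℓ : ℝ} (hb0 : 0 < b) (hc : 120 ≤ c) (hw1 : 1 / 2 ≤ w)
    (hK : K = 4 * b + 6 + 64 * b * c) (hr0 : 0 < r) (hr6 : 1 ≤ 6 * r) (hrw : r ≤ Real.exp w)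
    (hℓ1 : 1 ≤ ℓ) :
    ∃ M : ℕ, ℓ ≤ M ∧ (M : ℝ) ≤ 2 * (ℓ * (16 * c * r * (K * w)) ^ b) ∧
      (ℓ / M) ^ b⁻¹ * Real.sqrt (1 + Real.log (M / ℓ)) ≤ (16 * c * r)⁻¹ := by
  have hℓ0 : 0 < ℓ := by linarith
  have hbc : 0 ≤ b * c := by positivity
  have hK6 : 6 ≤ K := by linarith
  have hw0 : 0 < w := by linarith
  set X := 16 * c * r with hX
  have hX1 : 1 ≤ X := by rw [hX]; nlinarith
  have hX0 : 0 < X := by linarith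
  have hy1 : 1 ≤ K * w := by nlinarith
  have hy0 : 0 < K * w := by linarith
  -- Then m₀^(-1/b) = 1/(X K w): the factor 1/X is the target accuracy, and K w is reserved for the
  -- square root of the logarithm.
  set m₀ := (X * (K * w)) ^ b with hm₀
  have hm₀1 : 1 ≤ m₀ := Real.one_le_rpow (by nlinarith) hb0.le
  have hm₀0 : 0 < m₀ := by linarith
  set M := ⌈ℓ * m₀⌉₊ with hM
  have hMlow : ℓ * m₀ ≤ M := Nat.le_ceil _
  have hℓm : 1 ≤ ℓ * m₀ := by nlinarith
  have hMup : (M : ℝ) ≤ 2 * (ℓ * m₀) := by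
    have := (Nat.ceil_lt_add_one (by linarith : 0 ≤ ℓ * m₀)).le
    linarith
  have hℓM : ℓ ≤ M := by nlinarith
  have hM0 : (0 : ℝ) < M := by linarith
  set m : ℝ := M / ℓ with hm
  have hmlow : m₀ ≤ m := (le_div_iff₀ hℓ0).2 (by linarith)
  have hmup : m ≤ 2 * m₀ := (div_le_iff₀ hℓ0).2 (by linarith)
  have hm0 : 0 < m := by positivity
  have hlogm : 1 + Real.log m ≤ (K * w) ^ 2 := by
    have h1 : Real.log m ≤ Real.log 2 + b * (Real.log (16 * c) + Real.log r + Real.log (K * w)) := by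
      refine (Real.log_le_log hm0 hmup).trans (le_of_eq ?_)
      rw [Real.log_mul (by norm_num) hm₀0.ne', hm₀, Real.log_rpow (by positivity),
        Real.log_mul hX0.ne' hy0.ne', hX, Real.log_mul (by positivity) hr0.ne']
    have h2 : Real.log (16 * c) ≤ 16 * c := Real.log_le_self (by positivity)
    have h3 : Real.log r ≤ w := (Real.log_le_iff_le_exp hr0).2 hrw
    have h4 : Real.log (K * w) ≤ K * w := Real.log_le_self hy0.le
    have h5 : b * (Real.log (16 * c) + Real.log r + Real.log (K * w)) ≤ b * (16 * c + w + K * w) := by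
      gcongr
    have h6 := batchFactor_log_bound hb0.le (by linarith : 0 ≤ c) hw1 hK
    linarith [Real.log_two_lt_d9]
  have hsqrt : Real.sqrt (1 + Real.log m) ≤ K * w := Real.sqrt_le_iff.2 ⟨hy0.le, hlogm⟩
  have hmq : (ℓ / M) ^ b⁻¹ ≤ (X * (K * w))⁻¹ := by
    rw [show ℓ / M = m⁻¹ by rw [hm, inv_div], Real.inv_rpow hm0.le]
    gcongr
    calc X * (K * w) = m₀ ^ b⁻¹ := by
          rw [hm₀, ← Real.rpow_mul (by positivity), mul_inv_cancel₀ hb0.ne', Real.rpow_one]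
      _ ≤ m ^ b⁻¹ := by gcongr
  refine ⟨M, hℓM, hMup, ?_⟩
  calc (ℓ / M) ^ b⁻¹ * Real.sqrt (1 + Real.log m) ≤ (X * (K * w))⁻¹ * (K * w) := by gcongr
    _ = X⁻¹ := by field_simp

variable {d : ℕ} {p L σ Δ₀ ε δ : ℝ}

/-- The logarithmic factor of the query complexity. -/
def logFactor (d : ℕ) (L σ Δ₀ ε δ : ℝ) : ℝ :=
  Real.log (2 + Real.sqrt d * (Real.sqrt (L * Δ₀) + σ) / (ε * δ))

lemma log_two_le_logFactor (hσ : 0 < σ) (hε : 0 < ε) (hδ : 0 < δ) :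
    Real.log 2 ≤ logFactor d L σ Δ₀ ε δ := by
  refine Real.log_le_log (by norm_num) ?_
  have : 0 ≤ Real.sqrt d * (Real.sqrt (L * Δ₀) + σ) / (ε * δ) := by positivity
  linarith

lemma ratio_le_exp_logFactor (hσ : 0 < σ) (hε : 0 < ε) (hδ : 0 < δ) :
    Real.sqrt d * (Real.sqrt (L * Δ₀) + σ) / (ε * δ) ≤ Real.exp (logFactor d L σ Δ₀ ε δ) := by
  have : 0 ≤ Real.sqrt d * (Real.sqrt (L * Δ₀) + σ) / (ε * δ) := by positivity
  rw [logFactor, Real.exp_log (by linarith)]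
  linarith

lemma eps_le_six_mul (h : ε ^ 2 ≤ 32 * L * Δ₀) :
    ε ≤ 6 * Real.sqrt (L * Δ₀) := by
  have hLΔ : 0 ≤ L * Δ₀ := by nlinarith [sq_nonneg ε]
  refine le_of_sq_le_sq ?_ (by positivity)
  rw [mul_pow, Real.sq_sqrt hLΔ]
  linarith

/-- The smoothing parameter of the query bound. -/
def smoothing (d : ℕ) (L ε : ℝ) : ℝ := ε / (8 * L * Real.sqrt d)

lemma gapBar_smoothing_le (hd : 1 ≤ d) (hL : 0 < L) (h : ε ^ 2 ≤ 32 * L * Δ₀) :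
    gapBar L Δ₀ (smoothing d L ε) ≤ 5 / 4 * Δ₀ := by
  have hd' : (1 : ℝ) ≤ d := Nat.one_le_cast.2 hd
  have h1 : L * smoothing d L ε ^ 2 / 2 = ε ^ 2 / (128 * L * d) := by
    rw [smoothing, div_pow, mul_pow, Real.sq_sqrt (by linarith)]; field_simp; ring
  have h2 : ε ^ 2 / (128 * L * d) ≤ Δ₀ / 4 := by
    rw [div_le_iff₀ (by positivity)]
    have h3 : 0 ≤ L * Δ₀ := by nlinarith [sq_nonneg ε]
    nlinarith
  rw [gapBar, h1]; linarith

lemma mul_scale_smoothing_le (hd : 1 ≤ d) (hL : 0 < L) (hσ : 0 < σ)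
    (h : ε ^ 2 ≤ 32 * L * Δ₀) :
    d * scale d L σ Δ₀ (smoothing d L ε) ≤ 2 * (Real.sqrt d * (Real.sqrt (L * Δ₀) + σ)) := by
  have hd' : (0 : ℝ) < d := Nat.cast_pos.2 (by omega)
  have hsd : 0 < Real.sqrt d := Real.sqrt_pos.2 hd'
  have hLΔ : 0 ≤ L * Δ₀ := by nlinarith [sq_nonneg ε]
  have h1 : Real.sqrt (L * gapBar L Δ₀ (smoothing d L ε)) ≤ 5 / 4 * Real.sqrt (L * Δ₀) := by
    refine Real.sqrt_le_iff.2 ⟨by positivity, ?_⟩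
    rw [mul_pow, Real.sq_sqrt hLΔ]
    have := mul_le_mul_of_nonneg_left (gapBar_smoothing_le hd hL h) hL.le
    linarith
  have h2 := eps_le_six_mul h
  have hsq : (d : ℝ) = Real.sqrt d * Real.sqrt d := (Real.mul_self_sqrt hd'.le).symm
  -- The factor 1/√d in μ makes d L μ = √d ε/8, so this term also scales with √d instead of d.
  have e : d * scale d L σ Δ₀ (smoothing d L ε) = Real.sqrt d
      * (Real.sqrt (L * gapBar L Δ₀ (smoothing d L ε)) + σ + ε / 8) := by
    rw [scale, smoothing]
    generalize Real.sqrt (L * gapBar L Δ₀ (ε / (8 * L * Real.sqrt d))) = A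
    conv_lhs => rw [hsq]
    rw [Real.sqrt_mul_self hsd.le]
    field_simp
  rw [e]
  have : Real.sqrt (L * gapBar L Δ₀ (smoothing d L ε)) + σ + ε / 8
      ≤ 2 * (Real.sqrt (L * Δ₀) + σ) := by linarith
  calc _ ≤ Real.sqrt d * (2 * (Real.sqrt (L * Δ₀) + σ)) := by gcongr
    _ = _ := by ring

lemma eps_sq_le_gapBar {μ : ℝ} (hL : 0 < L) (h : ε ^ 2 ≤ 32 * L * Δ₀) :
    ε ^ 2 ≤ 32 * L * gapBar L Δ₀ μ := by
  have : 0 ≤ 32 * L * (L * μ ^ 2 / 2) := by positivity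
  rw [gapBar, mul_add]; linarith

lemma horizon_smoothing_mul_le (hd : 1 ≤ d) (hL : 0 < L) (hε : 0 < ε)
    (h : ε ^ 2 ≤ 32 * L * Δ₀) :
    horizon L Δ₀ (smoothing d L ε) ε * ε ^ 2 ≤ 120 * (L * Δ₀) := by
  have h1 := horizon_mul_le hε (eps_sq_le_gapBar (μ := smoothing d L ε) hL h)
  have h2 := mul_le_mul_of_nonneg_left (gapBar_smoothing_le hd hL h) hL.le
  linarith

lemma log_horizon_le (hd : 1 ≤ d) (hL : 0 < L) (hσ : 0 < σ) (hε : 0 < ε) (hδ : 0 < δ)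
    (hδ₁ : δ ≤ 1) (h : ε ^ 2 ≤ 32 * L * Δ₀) :
    Real.log (horizon L Δ₀ (smoothing d L ε) ε / δ) ≤ 9 * logFactor d L σ Δ₀ ε δ := by
  have hd' : (1 : ℝ) ≤ d := Nat.one_le_cast.2 hd
  have hLΔ : 0 ≤ L * Δ₀ := by nlinarith [sq_nonneg ε]
  have hT := horizon_smoothing_mul_le hd hL hε h
  have hT0 : (0 : ℝ) < horizon L Δ₀ (smoothing d L ε) ε := by
    have := three_le_horizon (L := L) (Δ₀ := Δ₀) (μ := smoothing d L ε) (ε := ε)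
    exact_mod_cast (by omega)
  set w := logFactor d L σ Δ₀ ε δ with hw
  have hlw : Real.log 2 ≤ w := log_two_le_logFactor hσ hε hδ
  -- Rounding 120 up to 2⁷ gives log(T/δ) ≤ 7 log 2 + 2w, at most 9w as log 2 ≤ w.
  have h1 : (horizon L Δ₀ (smoothing d L ε) ε : ℝ) / δ
      ≤ 2 ^ 7 * (Real.sqrt d * (Real.sqrt (L * Δ₀) + σ) / (ε * δ)) ^ 2 := by
    rw [div_pow, mul_pow, mul_pow, Real.sq_sqrt (by linarith), div_le_iff₀ hδ]
    have h2 : L * Δ₀ ≤ (Real.sqrt (L * Δ₀) + σ) ^ 2 := by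
      nlinarith [Real.sq_sqrt hLΔ, Real.sqrt_nonneg (L * Δ₀)]
    have h3 : (horizon L Δ₀ (smoothing d L ε) ε : ℝ) ≤ 120 * (L * Δ₀) / ε ^ 2 :=
      (le_div_iff₀ (by positivity)).2 hT
    have h4 : (Real.sqrt (L * Δ₀) + σ) ^ 2 ≤ d * (Real.sqrt (L * Δ₀) + σ) ^ 2 / δ := by
      rw [le_div_iff₀ hδ]
      have : 0 ≤ (Real.sqrt (L * Δ₀) + σ) ^ 2 := sq_nonneg _
      nlinarith
    calc (horizon L Δ₀ (smoothing d L ε) ε : ℝ) ≤ 120 * (L * Δ₀) / ε ^ 2 := h3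
      _ ≤ 2 ^ 7 * (d * (Real.sqrt (L * Δ₀) + σ) ^ 2 / δ) / ε ^ 2 := by
        gcongr
        · norm_num
        · exact h2.trans h4
      _ = _ := by field_simp
  have h2 : (horizon L Δ₀ (smoothing d L ε) ε : ℝ) / δ ≤ 2 ^ 7 * Real.exp w ^ 2 := by
    refine h1.trans ?_
    gcongr
    exact ratio_le_exp_logFactor hσ hε hδ
  calc _ ≤ Real.log (2 ^ 7 * Real.exp w ^ 2) := Real.log_le_log (by positivity) h2
    _ = 7 * Real.log 2 + 2 * w := by
      rw [Real.log_mul (by positivity) (by positivity), Real.log_pow, Real.log_pow, Real.log_exp]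
      norm_num
    _ ≤ 9 * w := by linarith

/-- An admissible choice of parameters with few queries. -/
lemma exists_admissible_queries_le (hp₁ : 1 < p) (hd : 1 ≤ d) (hL : 0 < L) (hσ : 0 < σ)
    (hε : 0 < ε) (hδ : 0 < δ) (hδ₁ : δ ≤ 1) (h : ε ^ 2 ≤ 32 * L * Δ₀) :
    ∃ (μ : ℝ) (M : ℕ), Admissible d p L σ Δ₀ ε δ μ M ∧
      ((2 * M * horizon L Δ₀ μ ε : ℕ) : ℝ) ≤
        (4320 * (16 * constC p * batchFactor p) ^ (p / (p - 1)) * 2 ^ ⌈1 + p / (p - 1)⌉₊)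
          * (L * Δ₀) * (Real.sqrt (L * Δ₀) + σ) ^ (p / (p - 1))
          * ((d : ℝ) ^ (p / (2 * (p - 1))) / ε ^ ((3 * p - 2) / (p - 1)))
          * Real.log (2 + Real.sqrt d * (Real.sqrt (L * Δ₀) + σ) / (ε * δ)) ^ ⌈1 + p / (p - 1)⌉₊ := by
  have hp0 : 0 < p := by linarith
  have hp1 : 0 < p - 1 := by linarith
  have hd' : (1 : ℝ) ≤ d := Nat.one_le_cast.2 hd
  have hd0 : (0 : ℝ) < d := by linarith
  have hsd1 : 1 ≤ Real.sqrt d := Real.one_le_sqrt.2 hd'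
  have hLΔ : 0 ≤ L * Δ₀ := by nlinarith [sq_nonneg ε]
  have hc := constC_ge hp₁
  set c := constC p with hcdef
  set b := p / (p - 1) with hb
  have hb0 : 0 < b := by positivity
  have hq : (p - 1) / p = b⁻¹ := by rw [hb, inv_div]
  have hK : batchFactor p = 4 * b + 6 + 64 * b * c := rfl
  set K := batchFactor p with hKdef
  have hK0 : 0 < K := by rw [hK]; positivity
  have hε6 := eps_le_six_mul h
  set R := Real.sqrt (L * Δ₀) + σ with hR
  have hR0 : 0 < R := by positivity
  set w := logFactor d L σ Δ₀ ε δ with hw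
  have hw2 : Real.log 2 ≤ w := log_two_le_logFactor hσ hε hδ
  have hw1 : 1 / 2 ≤ w := by linarith [Real.log_two_gt_d9]
  set μ := smoothing d L ε with hμ
  have hμ0 : 0 < μ := by rw [hμ, smoothing]; positivity
  set T := horizon L Δ₀ μ ε with hT
  set ℓ := Real.log (T / δ) with hℓ
  have hℓ1 : 1 ≤ ℓ := one_le_log_horizon_div hδ hδ₁
  have hℓ0 : 0 < ℓ := by linarith
  have hℓw : ℓ ≤ 9 * w := log_horizon_le hd hL hσ hε hδ hδ₁ h
  have hTε : T * ε ^ 2 ≤ 120 * (L * Δ₀) := horizon_smoothing_mul_le hd hL hε h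
  set r := Real.sqrt d * R / ε with hr
  have hr0 : 0 < r := by positivity
  have hr6 : 1 ≤ 6 * r := by
    rw [hr, mul_div_assoc', le_div_iff₀ hε]
    have : R ≤ Real.sqrt d * R := le_mul_of_one_le_left hR0.le hsd1
    linarith
  have hrw : r ≤ Real.exp w := by
    refine le_trans ?_ (ratio_le_exp_logFactor hσ hε hδ)
    rw [hr]
    gcongr
    exact mul_le_of_le_one_right hε.le hδ₁
  obtain ⟨M, hℓM, hMup, hMq⟩ := exists_batch_size hb0 hc hw1 hK hr0 hr6 hrw hℓ1
  have hM0 : (0 : ℝ) < M := by linarith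
  refine ⟨μ, M, ⟨hμ0, hℓM, ?_, eps_sq_le_gapBar hL h⟩, ?_⟩
  · have hdS := mul_scale_smoothing_le (σ := σ) hd hL hσ h
    have hS0 : 0 ≤ scale d L σ Δ₀ μ := by rw [scale]; positivity
    have hLμ : L * μ ≤ ε / 8 := by
      rw [hμ, smoothing, show L * (ε / (8 * L * Real.sqrt d)) = ε / 8 / Real.sqrt d by field_simp]
      exact div_le_self (by positivity) hsd1
    rw [eta, hq]
    have hX0 : 0 < 16 * c * r := by positivity
    calc c * d * scale d L σ Δ₀ μ * (ℓ / M) ^ b⁻¹ * Real.sqrt (1 + Real.log (M / ℓ)) + L * μ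
        = c * (d * scale d L σ Δ₀ μ) * ((ℓ / M) ^ b⁻¹ * Real.sqrt (1 + Real.log (M / ℓ)))
          + L * μ := by ring
      _ ≤ c * (2 * (Real.sqrt d * R)) * (16 * c * r)⁻¹ + ε / 8 := by gcongr
      -- The 16 in the target accuracy makes the stochastic part exactly ε/8; smoothing takes the
      -- other ε/8.
      _ = ε / 4 := by rw [hr]; field_simp; ring
  -- w may be below 1, so its exponent cannot be rounded up directly; 2w ≥ 1 allows it at the price
  -- of a power of 2.
  · have hwk : w * w ^ b ≤ 2 ^ ⌈1 + b⌉₊ * w ^ ⌈1 + b⌉₊ := by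
      have hw0 : 0 < w := by linarith
      calc w * w ^ b = w ^ (1 + b) := by rw [Real.rpow_add hw0, Real.rpow_one]
        _ ≤ (2 * w) ^ (1 + b) := by gcongr; linarith
        _ ≤ (2 * w) ^ ((⌈1 + b⌉₊ : ℕ) : ℝ) :=
          Real.rpow_le_rpow_of_exponent_le (by linarith) (Nat.le_ceil _)
        _ = _ := by rw [Real.rpow_natCast, mul_pow]
    have hTle : (T : ℝ) ≤ 120 * (L * Δ₀) / ε ^ 2 := (le_div_iff₀ (by positivity)).2 hTε
    have hw0 : 0 < w := by linarith
    have hm₀e : (16 * c * r * (K * w)) ^ b = (16 * c * K) ^ b * r ^ b * w ^ b := by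
      rw [← Real.mul_rpow (by positivity) (by positivity),
        ← Real.mul_rpow (by positivity) (by positivity)]
      congr 1; ring
    have hre : r ^ b / ε ^ 2
        = R ^ b * ((d : ℝ) ^ (p / (2 * (p - 1))) / ε ^ ((3 * p - 2) / (p - 1))) := by
      have e1 : (d : ℝ) ^ (p / (2 * (p - 1))) = Real.sqrt d ^ b := by
        rw [Real.sqrt_eq_rpow, ← Real.rpow_mul hd0.le, hb]
        congr 1; field_simp
      have e2 : ε ^ ((3 * p - 2) / (p - 1)) = ε ^ b * ε ^ 2 := by
        rw [← Real.rpow_two, ← Real.rpow_add hε, hb]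
        congr 1; field_simp; ring
      rw [e1, e2, hr, Real.div_rpow (by positivity) hε.le, Real.mul_rpow (by positivity) hR0.le]
      field_simp
    have hgoal : ((2 * M * T : ℕ) : ℝ) ≤ 4320 * (16 * c * K) ^ b * (L * Δ₀) * (r ^ b / ε ^ 2)
        * (w * w ^ b) := by
      push_cast
      -- The constant 4320 is 2 · 2 · 9 · 120: two queries per sample, rounding of M, the bound on
      -- ℓ, and the bound on T.
      calc 2 * (M : ℝ) * T ≤ 2 * (2 * (9 * w * (16 * c * r * (K * w)) ^ b)) * (120 * (L * Δ₀) / ε ^ 2) := by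
            gcongr
            exact hMup.trans (by gcongr)
        _ = _ := by rw [hm₀e]; ring
    refine hgoal.trans ?_
    rw [hre]
    change _ ≤ 4320 * (16 * c * K) ^ b * 2 ^ ⌈1 + b⌉₊ * (L * Δ₀) * R ^ b
      * ((d : ℝ) ^ (p / (2 * (p - 1))) / ε ^ ((3 * p - 2) / (p - 1))) * w ^ ⌈1 + b⌉₊
    calc _ ≤ 4320 * (16 * c * K) ^ b * (L * Δ₀)
          * (R ^ b * ((d : ℝ) ^ (p / (2 * (p - 1))) / ε ^ ((3 * p - 2) / (p - 1))))
          * (2 ^ ⌈1 + b⌉₊ * w ^ ⌈1 + b⌉₊) := by gcongr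
      _ = _ := by ring

end Complexity

end

end RSCZO

/-! ### The main theorem. -/

theorem theorem2 (p : ℝ) (hp₁ : 1 < p) (hp₂ : p ≤ 2) :
    -- constants that depend on `p` only
    ∃ C : ℝ, 0 < C ∧ ∃ k : ℕ,
    ∀ (d : ℕ) (L σ Δ₀ ε δ : ℝ), 1 ≤ d → 0 < L → 0 < σ → 0 < ε → 0 < δ → δ ≤ 1 →
    -- convergence with high probability, and the number of oracle queries
    (∀ (μ : ℝ) (M : ℕ), RSCZO.Admissible d p L σ Δ₀ ε δ μ M →
      ∀ (Ξ : Type*) [MeasurableSpace Ξ] (P : MeasureTheory.Measure Ξ)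
        [MeasureTheory.IsProbabilityMeasure P]
        (F : RSCZO.E d → Ξ → ℝ) (x₀ : RSCZO.E d),
        RSCZO.Assumptions P F L σ p →
        RSCZO.initialGap P F x₀ = Δ₀ →
      ∀ (Ω : Type*) [MeasurableSpace Ω] (ν : MeasureTheory.Measure Ω)
        [MeasureTheory.IsProbabilityMeasure ν]
        (u : ℕ → Fin M → Ω → RSCZO.Sph d) (ξ : ℕ → Fin M → Ω → Ξ),
        RSCZO.IsSampleStream ν P u ξ →
      ∀ (T : ℕ) (τ α : ℝ), T = RSCZO.horizon L Δ₀ μ ε →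
        τ = RSCZO.threshold d p L σ Δ₀ μ δ M T → α = 1 / (4 * L) →
      ∀ x : ℕ → Ω → RSCZO.E d,
        (∀ t ω, x t ω = RSCZO.iterates F μ τ α x₀ (fun s ℓ => u s ℓ ω) (fun s ℓ => ξ s ℓ ω) t) →
      (∃ A : Set Ω, MeasurableSet A ∧ ENNReal.ofReal (1 - δ) ≤ ν A ∧
        ∀ ω ∈ A,
          (1 / (T : ℝ)) * ∑ t ∈ Finset.range T,
            ‖gradient (RSCZO.objective P F) (x t ω)‖ ^ 2 ≤ ε ^ 2 ∧
          ∃ t < T, ‖gradient (RSCZO.objective P F) (x t ω)‖ ≤ ε) ∧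
      ∀ ω, (RSCZO.queryLog F μ τ α x₀ (fun s ℓ => u s ℓ ω) (fun s ℓ => ξ s ℓ ω) T).length
        = 2 * M * T) ∧
    -- the query complexity: some admissible choice of `μ` and `M` makes few queries
    (ε ^ 2 ≤ 32 * L * Δ₀ →
      ∃ (μ : ℝ) (M : ℕ), RSCZO.Admissible d p L σ Δ₀ ε δ μ M ∧
        ((2 * M * RSCZO.horizon L Δ₀ μ ε : ℕ) : ℝ) ≤
          C * (L * Δ₀) * (Real.sqrt (L * Δ₀) + σ) ^ (p / (p - 1))
            * ((d : ℝ) ^ (p / (2 * (p - 1))) / ε ^ ((3 * p - 2) / (p - 1)))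
            * Real.log (2 + Real.sqrt d * (Real.sqrt (L * Δ₀) + σ) / (ε * δ)) ^ k) := by
  have hp1 : 0 < p - 1 := by linarith
  have hc := RSCZO.constC_ge hp₁
  have hK : 0 < RSCZO.batchFactor p := by rw [RSCZO.batchFactor]; positivity
  refine ⟨4320 * (16 * RSCZO.constC p * RSCZO.batchFactor p) ^ (p / (p - 1))
    * 2 ^ ⌈1 + p / (p - 1)⌉₊, by positivity, ⌈1 + p / (p - 1)⌉₊, ?_⟩
  intro d L σ Δ₀ ε δ hd hL hσ hε hδ hδ₁
  have : NeZero d := ⟨by omega⟩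
  refine ⟨?_, RSCZO.exists_admissible_queries_le hp₁ hd hL hσ hε hδ hδ₁⟩
  intro μ M had Ξ _ P _ F x₀ hA h0 Ω _ ν _ u ξ hs T τ α hT hτ hα x hx
  subst hα
  refine ⟨?_, fun ω => RSCZO.length_queryLog _ _ _ _ _ _ _ _⟩
  obtain ⟨A, hAm, hAν, hconv⟩ := RSCZO.exists_event_convergence hp₁ hp₂ hL hσ hε hδ hδ₁ had hA h0
    hs hT hτ hx
  refine ⟨A, hAm, hAν, fun ω hω => ⟨hconv ω hω, ?_⟩⟩
  have hT3 : 3 ≤ T := hT ▸ RSCZO.three_le_horizon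
  exact RSCZO.exists_norm_le_of_average_sq_le hε.le (by omega) (hconv ω hω)
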